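/- Let $\mathbb D$ be the open unit disc and let $\alpha$ be a real number such that $\alpha+2$ is neither zero nor a negative integer. Let $A^2_\alpha$ be the space of holomorphic functions $f$ on $\mathbb D$ for which there is an integer $k\ge 0$ with $\alpha+2k>-1$ and $\int_{\mathbb D}|(1-|z|^2)^kf^{(k)}(z)|^2(1-|z|^2)^\alpha\,dA(z)<\infty$. Let $N=0$ if $\alpha+2>0$, and otherwise let $N$ be the positive integer with $-N<\alpha+2<-N+1$. Let $Q$ be a real polynomial of degree at most $N$, with $Q=0$ if $\alpha+2>0$, such that all Taylor coefficients $\kappa_n$ ($n\ge 0$) of $(-1)^N(1-x)^{-(\alpha+2)}+Q(x)$ at $x=0$ are positive. Equip $A^2_\alpha$ with the inner product in which the monomials are orthogonal and $\|z^n\|^2=1/\kappa_n$, that is, make it the Hilbert space with reproducing kernel $$K_\alpha(z,w)=\frac{(-1)^N}{(1-z\bar w)^{\alpha+2}}+Q(z\bar w).$$ Let $a,b,c,d\in\mathbb C$ with $ad-bc\neq 0$ be such that $\varphi(z)=(az+b)/(cz+d)$ is a self-map of $\mathbb D$ (with $cz+d\ne0$ on $\mathbb D$), and let $\sigma(z)=(\bar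 az-\bar c)/(-\bar bz+\bar d)$ be its Kreĭn adjoint. Let $$h(z)=(cz+d)^{\alpha+2}=e^{(\alpha+2)\log(cz+d)},\qquad g(z)=(-\bar bz+\bar d)^{-\alpha-2}=e^{-(\alpha+2)\log(-\bar bz+\bar d)}\qquad(z\in\mathbb D),$$ where the logarithms are continuous branches on $\mathbb D$ whose values at $z=0$ are complex conjugates of each other. Then $\sigma$ is a well-defined self-map of $\mathbb D$; the composition operators $C_\varphi f=f\circ\varphi$, $C_\sigma f=f\circ\sigma$ and the multiplication operators $M_gf=gf$, $M_hf=hf$ are bounded on $A^2_\alpha$; and the operator $C_\varphi^*-M_gC_\sigma M_h^*$ has finite rank on $A^2_\alpha$. If $\alpha+2>0$, then $C_\varphi^*=M_gC_\sigma M_h^*$. -/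

import Mathlib

open scoped ComplexConjugate Complex.UnitDisc

section

open MeasureTheory Filter Topology Set Asymptotics
open scoped ENNReal Nat Real

namespace BergmanAux

theorem gamma_add_isTheta (s : ℝ) (hs : ∀ n : ℕ, s ≠ -(n : ℝ)) :
    (fun n : ℕ => Real.Gamma (n + s)) =Θ[atTop] fun n : ℕ => (n ! : ℝ) * (n : ℝ) ^ (s - 1) := by
  by_cases h1 : s = 1
  · subst h1
    simp only [Real.Gamma_nat_eq_factorial, sub_self, Real.rpow_zero, mul_one]
    exact isTheta_refl _ _
  have hs' : ∀ n : ℕ, s - 1 ≠ -(n : ℝ) := by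
    intro n hn
    rcases n with _ | n
    · apply h1; simp at hn; linarith
    · apply hs n; push_cast at hn; linarith
  have hG : Real.Gamma (s - 1) ≠ 0 := Real.Gamma_ne_zero hs'
  have hprod : ∀ n : ℕ, Real.Gamma (n + s) =
      (∏ j ∈ Finset.range (n + 1), (s - 1 + j)) * Real.Gamma (s - 1) := by
    intro n
    induction n with
    | zero =>
      have := Real.Gamma_add_one (s := s - 1) (by simpa using hs' 0)
      simp at this ⊢
      exact this
    | succ n ih =>
      rw [Finset.prod_range_succ, mul_right_comm, ← ih, Nat.cast_succ,
        show (n : ℝ) + 1 + s = (n + s) + 1 by ring, Real.Gamma_add_one]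
      · ring
      · intro h; apply hs n; linarith
  have ht := Real.GammaSeq_tendsto_Gamma (s - 1)
  have h2 : (Real.GammaSeq (s - 1)) =Θ[atTop] fun _ : ℕ => (1 : ℝ) :=
    (IsEquivalent.isTheta ((isEquivalent_const_iff_tendsto hG).2 ht)).trans
      (isTheta_const_const hG one_ne_zero)
  have h3 : (fun n : ℕ => Real.Gamma (n + s) * Real.GammaSeq (s - 1) n)
      = fun n : ℕ => Real.Gamma (s - 1) * ((n ! : ℝ) * (n : ℝ) ^ (s - 1)) := by
    funext n
    have hp : (∏ j ∈ Finset.range (n + 1), (s - 1 + (j : ℝ))) ≠ 0 :=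
      Finset.prod_ne_zero_iff.2 fun j _ h => hs' j (by linarith)
    rw [hprod, Real.GammaSeq]
    field_simp
  have h4 : (fun n : ℕ => Real.Gamma (n + s)) =Θ[atTop]
      fun n : ℕ => Real.Gamma (n + s) * Real.GammaSeq (s - 1) n := by
    simpa using ((isTheta_refl (fun n : ℕ => Real.Gamma (n + s)) atTop).mul h2.symm)
  rw [h3] at h4
  exact h4.trans ((isTheta_const_mul_left hG).2 (isTheta_refl _ _))

theorem lintegral_radial (β : ℝ) (hβ : -1 < β) (n : ℕ) :
    ∫⁻ r in Ioo (0 : ℝ) 1, ENNReal.ofReal (r * (1 - r ^ 2) ^ β * (r ^ 2) ^ n) =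
      ENNReal.ofReal (2⁻¹ * ProbabilityTheory.beta (n + 1) (β + 1)) := by
  have hn : (0 : ℝ) < n + 1 := by positivity
  have hb : 0 < ProbabilityTheory.beta (n + 1) (β + 1) :=
    ProbabilityTheory.beta_pos hn (by linarith)
  have h1 := ProbabilityTheory.lintegral_betaPDF_eq_one hn (show 0 < β + 1 by linarith)
  rw [ProbabilityTheory.lintegral_betaPDF] at h1
  have him : (fun r : ℝ => r ^ 2) '' Ioo 0 1 = Ioo 0 1 := by
    ext x
    simp only [mem_image, mem_Ioo]
    constructor
    · rintro ⟨r, ⟨h0, h1⟩, rfl⟩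
      exact ⟨by positivity, by nlinarith⟩
    · rintro ⟨h0, h1⟩
      exact ⟨√x, ⟨Real.sqrt_pos.2 h0, by rw [Real.sqrt_lt' one_pos]; simpa⟩, Real.sq_sqrt h0.le⟩
  have h2 := lintegral_image_eq_lintegral_abs_deriv_mul (s := Ioo (0 : ℝ) 1)
    (f := fun r => r ^ 2) (f' := fun r => 2 * r) measurableSet_Ioo
    (fun x _ => by simpa using (hasDerivAt_pow 2 x).hasDerivWithinAt)
    (fun x hx y hy h => by
      have := (sq_eq_sq₀ hx.1.le hy.1.le).1 h
      exact this)
    (fun x => ENNReal.ofReal (1 / ProbabilityTheory.beta (n + 1) (β + 1) * x ^ ((n : ℝ) + 1 - 1)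
      * (1 - x) ^ (β + 1 - 1)))
  rw [him, h1] at h2
  have h3 : ∀ r ∈ Ioo (0 : ℝ) 1, ENNReal.ofReal (r * (1 - r ^ 2) ^ β * (r ^ 2) ^ n) =
      ENNReal.ofReal (2⁻¹ * ProbabilityTheory.beta (n + 1) (β + 1)) *
      (ENNReal.ofReal |2 * r| * ENNReal.ofReal (1 / ProbabilityTheory.beta (n + 1) (β + 1) *
        (r ^ 2) ^ ((n : ℝ) + 1 - 1) * (1 - r ^ 2) ^ (β + 1 - 1))) := by
    intro r hr
    rw [abs_of_pos (by linarith [hr.1]), ← ENNReal.ofReal_mul (by linarith [hr.1]),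
      ← ENNReal.ofReal_mul (by positivity)]
    congr 1
    simp only [add_sub_cancel_right, Real.rpow_natCast]
    field_simp
  rw [setLIntegral_congr_fun measurableSet_Ioo h3, lintegral_const_mul, ← h2, mul_one]
  fun_prop

theorem integral_exp_int (k : ℤ) :
    ∫ θ in Ioo (-π) π, Complex.exp (k * θ * Complex.I) =
      if k = 0 then (2 * π : ℂ) else 0 := by
  rw [← integral_Ioc_eq_integral_Ioo, ← intervalIntegral.integral_of_le (by linarith [Real.pi_pos])]
  split_ifs with h
  · subst h
    simp
    ring
  · have hk : (k : ℂ) * Complex.I ≠ 0 := by simp [h]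
    have : ∀ θ : ℝ, (k : ℂ) * θ * Complex.I = k * Complex.I * θ := fun θ => by ring
    simp_rw [this]
    rw [integral_exp_mul_complex hk, div_eq_zero_iff]
    left
    rw [sub_eq_zero, Complex.exp_eq_exp_iff_exists_int]
    exact ⟨k, by push_cast; ring⟩

theorem hasSum_mul_of_norm (u v : ℕ → ℂ) (a b : ℂ) (h1 : HasSum u a) (h2 : HasSum v b)
    (hu : Summable fun n => ‖u n‖) (hv : Summable fun n => ‖v n‖) :
    HasSum (fun p : ℕ × ℕ => u p.1 * v p.2) (a * b) := by
  have h4 := summable_mul_of_summable_norm hu hv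
  exact HasSum.mul h1 h2 h4

theorem hasSum_mul_conj (u : ℕ → ℂ) (hu : Summable fun n => ‖u n‖) :
    HasSum (fun p : ℕ × ℕ => u p.1 * conj (u p.2)) ((∑' n, u n) * conj (∑' n, u n)) := by
  have h1 : HasSum u (∑' n, u n) := hu.of_norm.hasSum
  have h2 : HasSum (fun n => conj (u n)) (conj (∑' n, u n)) :=
    h1.map (starRingEnd ℂ) Complex.continuous_conj
  have h3 : Summable fun n => ‖conj (u n)‖ := hu.congr fun n => (RCLike.norm_conj _).symm
  exact hasSum_mul_of_norm u (fun n => conj (u n)) _ _ h1 h2 hu h3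

/-- Parseval's identity for an absolutely convergent one-sided trigonometric series. -/
theorem parseval (c : ℕ → ℂ) (hc : Summable fun n => ‖c n‖) :
    ∫⁻ θ in Ioo (-π) π, ‖∑' n, c n * Complex.exp (n * θ * Complex.I)‖ₑ ^ 2 =
      ENNReal.ofReal (2 * π) * ∑' n, ENNReal.ofReal (‖c n‖ ^ 2) := by
  have hne : ∀ (n : ℕ) (θ : ℝ), ‖Complex.exp (n * θ * Complex.I)‖ = 1 := fun n θ => by
    have := Complex.norm_exp_ofReal_mul_I (n * θ)
    push_cast at this
    exact this
  have hs : ∀ θ : ℝ, Summable fun n : ℕ => ‖c n * Complex.exp (n * θ * Complex.I)‖ := fun θ => by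
    simpa [hne] using hc
  set G : ℝ → ℂ := fun θ => ∑' n, c n * Complex.exp (n * θ * Complex.I) with hG
  have hGc : Continuous G :=
    continuous_tsum (fun n => by fun_prop) hc fun n θ => by simp [hne]
  have hprod : ∀ θ : ℝ, HasSum (fun p : ℕ × ℕ => (c p.1 * Complex.exp (p.1 * θ * Complex.I)) *
      conj (c p.2 * Complex.exp (p.2 * θ * Complex.I))) (G θ * conj (G θ)) := by
    intro θ
    exact hasSum_mul_conj (fun n : ℕ => c n * Complex.exp (n * θ * Complex.I)) (hs θ)
  have hterm : ∀ (p : ℕ × ℕ) (θ : ℝ), (c p.1 * Complex.exp (p.1 * θ * Complex.I)) *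
      conj (c p.2 * Complex.exp (p.2 * θ * Complex.I)) =
      (c p.1 * conj (c p.2)) * Complex.exp (((p.1 : ℤ) - (p.2 : ℤ) : ℤ) * θ * Complex.I) := by
    intro p θ
    rw [map_mul, ← Complex.exp_conj, mul_mul_mul_comm, ← Complex.exp_add]
    congr 2
    simp
    ring
  have hint := hasSum_integral_of_summable_integral_norm (μ := volume.restrict (Ioo (-π) π))
    (F := fun (p : ℕ × ℕ) (θ : ℝ) => (c p.1 * Complex.exp (p.1 * θ * Complex.I)) *
      conj (c p.2 * Complex.exp (p.2 * θ * Complex.I)))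
    (fun p => (Continuous.integrableOn_Icc (by fun_prop)).mono_set Ioo_subset_Icc_self) (by
      have : Summable fun p : ℕ × ℕ => (‖c p.1‖ * ‖c p.2‖) * (2 * π) :=
        (hc.mul_of_nonneg hc (fun _ => norm_nonneg _) (fun _ => norm_nonneg _)).mul_right _
      convert this using 2 with p
      simp [hne, Real.pi_pos.le]
      ring)
  simp_rw [fun θ : ℝ => (hprod θ).tsum_eq, hterm, integral_const_mul, integral_exp_int] at hint
  have hdiag : HasSum (fun n : ℕ => (c n * conj (c n)) * ((2 * π : ℝ) : ℂ))
      (∫ θ in Ioo (-π) π, G θ * conj (G θ)) := by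
    have hinj : Function.Injective (fun n : ℕ => (n, n)) := fun a b h => (Prod.mk.inj h).1
    rw [← hinj.hasSum_iff] at hint
    · have e : ∀ n : ℕ, c n * conj (c n) * ((2 * π : ℝ) : ℂ) =
          c n * conj (c n) * (if (n : ℤ) - (n : ℤ) = 0 then (2 * π : ℂ) else 0) := by simp
      simp_rw [e]
      exact hint
    · rintro ⟨a, b⟩ hab
      have : (a : ℤ) - b ≠ 0 := by
        intro h
        apply hab
        exact ⟨a, Prod.ext rfl (by change a = b; omega)⟩
      simp [this]
  have hdiag' : HasSum (fun n : ℕ => ‖c n‖ ^ 2 * (2 * π)) (∫ θ in Ioo (-π) π, ‖G θ‖ ^ 2) := by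
    rw [← Complex.hasSum_ofReal]
    convert hdiag using 1
    · funext n
      rw [Complex.mul_conj']
      push_cast; ring
    · rw [← integral_complex_ofReal]
      congr 1
      funext θ
      rw [Complex.mul_conj']
      push_cast; ring
  have h5 : ∀ θ, ‖G θ‖ₑ ^ 2 = ENNReal.ofReal (‖G θ‖ ^ 2) := fun θ => by
    rw [ENNReal.ofReal_pow (norm_nonneg _), ofReal_norm]
  change ∫⁻ θ in Ioo (-π) π, ‖G θ‖ₑ ^ 2 = _
  simp_rw [h5]
  rw [← ofReal_integral_eq_lintegral_ofReal
    ((Continuous.integrableOn_Icc (by fun_prop)).mono_set Ioo_subset_Icc_self)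
    (ae_of_all _ fun θ => by positivity), ← hdiag'.tsum_eq,
    ENNReal.ofReal_tsum_of_nonneg (fun n => by positivity) hdiag'.summable, ← ENNReal.tsum_mul_left]
  congr 1
  funext n
  rw [← ENNReal.ofReal_mul (by positivity), mul_comm]


theorem coeff_hasSum {F : ℂ → ℂ} (hF : DifferentiableOn ℂ F (Metric.ball 0 1)) {z : ℂ}
    (hz : z ∈ Metric.ball (0 : ℂ) 1) :
    HasSum (fun n : ℕ => iteratedDeriv n F 0 / (n ! : ℂ) * z ^ n) (F z) := by
  have := Complex.hasSum_taylorSeries_on_ball hF hz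
  have e : ∀ n : ℕ, iteratedDeriv n F 0 / (n ! : ℂ) * z ^ n =
      (n ! : ℂ)⁻¹ • (z - 0) ^ n • iteratedDeriv n F 0 := fun n => by
    rw [sub_zero, smul_eq_mul, smul_eq_mul]; ring
  simp_rw [e]
  exact this

theorem coeff_summable {F : ℂ → ℂ} (hF : DifferentiableOn ℂ F (Metric.ball 0 1)) {r : ℝ}
    (h0 : 0 ≤ r) (h1 : r < 1) : Summable fun n : ℕ => ‖iteratedDeriv n F 0 / (n ! : ℂ)‖ * r ^ n := by
  have := (coeff_hasSum hF (z := (r : ℂ)) (by simp [abs_of_nonneg h0, h1])).summable.norm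
  refine this.congr fun n => ?_
  rw [norm_mul, norm_pow, Complex.norm_real, Real.norm_of_nonneg h0]

theorem lintegral_disc {F : ℂ → ℂ} (hF : DifferentiableOn ℂ F (Metric.ball 0 1)) (β : ℝ)
    (hβ : -1 < β) :
    ∫⁻ z in Metric.ball (0 : ℂ) 1, ENNReal.ofReal ((1 - ‖z‖ ^ 2) ^ β) * ‖F z‖ₑ ^ 2 =
      ENNReal.ofReal π * ∑' n : ℕ, ENNReal.ofReal (‖iteratedDeriv n F 0 / (n ! : ℂ)‖ ^ 2 *
        ProbabilityTheory.beta (n + 1) (β + 1)) := by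
  set c : ℕ → ℂ := fun n => iteratedDeriv n F 0 / (n ! : ℂ) with hc
  have hmeas : Measurable ((Metric.ball (0 : ℂ) 1).indicator F) := by
    classical
    rw [← piecewise_eq_indicator]
    exact hF.continuousOn.measurable_piecewise continuousOn_const measurableSet_ball
  rw [← lintegral_indicator measurableSet_ball, ← Complex.lintegral_comp_polarCoord_symm,
    show polarCoord.target = Ioi (0 : ℝ) ×ˢ Ioo (-π) π from rfl, Measure.volume_eq_prod, ← Measure.prod_restrict]
  have hfun : ∀ p : ℝ × ℝ, p ∈ Ioi (0 : ℝ) ×ˢ Ioo (-π) π → ENNReal.ofReal p.1 •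
      (Metric.ball (0 : ℂ) 1).indicator (fun z => ENNReal.ofReal ((1 - ‖z‖ ^ 2) ^ β) * ‖F z‖ₑ ^ 2)
        (Complex.polarCoord.symm p) =
      (Ioo (0 : ℝ) 1).indicator (fun r => ENNReal.ofReal (r * (1 - r ^ 2) ^ β)) p.1 *
        ‖(Metric.ball (0 : ℂ) 1).indicator F (p.1 * Complex.exp (p.2 * Complex.I))‖ₑ ^ 2 := by
    rintro ⟨r, θ⟩ ⟨hr, -⟩
    have hr : 0 < r := hr
    have hz : Complex.polarCoord.symm (r, θ) = r * Complex.exp (θ * Complex.I) := by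
      rw [Complex.polarCoord_symm_apply, Complex.exp_mul_I]; simp
    have hnz : ‖(r : ℂ) * Complex.exp (θ * Complex.I)‖ = r := by
      simp [Complex.norm_exp_ofReal_mul_I, abs_of_pos hr]
    rw [hz]
    by_cases h1 : r < 1
    · have hm : (r : ℂ) * Complex.exp (θ * Complex.I) ∈ Metric.ball (0 : ℂ) 1 := by
        rw [mem_ball_zero_iff, hnz]; exact h1
      rw [indicator_of_mem hm, indicator_of_mem hm, indicator_of_mem (show r ∈ Ioo (0 : ℝ) 1 from ⟨hr, h1⟩),
        hnz, ENNReal.ofReal_mul hr.le, smul_eq_mul, mul_assoc]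
    · have hm : (r : ℂ) * Complex.exp (θ * Complex.I) ∉ Metric.ball (0 : ℂ) 1 := by
        rw [mem_ball_zero_iff, hnz]; exact h1
      rw [indicator_of_notMem hm, indicator_of_notMem hm]
      simp
  rw [Measure.prod_restrict, setLIntegral_congr_fun (measurableSet_Ioi.prod measurableSet_Ioo) hfun,
    ← Measure.prod_restrict, lintegral_prod]
  swap
  · apply Measurable.aemeasurable
    apply Measurable.mul
    · exact (Measurable.indicator (by fun_prop) measurableSet_Ioo).comp measurable_fst
    · exact ((hmeas.comp (by fun_prop)).enorm).pow_const 2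
  have hinner : ∀ r ∈ Ioi (0 : ℝ), ∫⁻ θ in Ioo (-π) π,
      (Ioo (0 : ℝ) 1).indicator (fun r => ENNReal.ofReal (r * (1 - r ^ 2) ^ β)) r *
        ‖(Metric.ball (0 : ℂ) 1).indicator F (r * Complex.exp (θ * Complex.I))‖ₑ ^ 2 =
      (Ioo (0 : ℝ) 1).indicator (fun r => ∑' n, ENNReal.ofReal (2 * π) *
        (ENNReal.ofReal (‖c n‖ ^ 2) *
        ENNReal.ofReal (r * (1 - r ^ 2) ^ β * (r ^ 2) ^ n))) r := by
    intro r hr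
    have hr : 0 < r := hr
    by_cases h1 : r < 1
    swap
    · simp [h1]
    have hmem : r ∈ Ioo (0 : ℝ) 1 := ⟨hr, h1⟩
    have h1r : 0 ≤ 1 - r ^ 2 := by nlinarith
    rw [indicator_of_mem hmem, indicator_of_mem hmem, lintegral_const_mul']
    swap
    · exact ENNReal.ofReal_ne_top
    have hFs : ∀ θ : ℝ, (Metric.ball (0 : ℂ) 1).indicator F (r * Complex.exp (θ * Complex.I)) =
        ∑' n : ℕ, (c n * r ^ n) * Complex.exp (n * θ * Complex.I) := by
      intro θ
      have hm : (r : ℂ) * Complex.exp (θ * Complex.I) ∈ Metric.ball (0 : ℂ) 1 := by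
        rw [mem_ball_zero_iff]
        simpa [Complex.norm_exp_ofReal_mul_I, abs_of_pos hr] using h1
      rw [indicator_of_mem hm, ← (coeff_hasSum hF hm).tsum_eq]
      congr 1
      funext n
      rw [mul_pow, ← Complex.exp_nat_mul, ← mul_assoc, ← mul_assoc]
    simp_rw [hFs]
    rw [parseval (fun n => c n * r ^ n)]
    swap
    · refine (coeff_summable hF hr.le h1).congr fun n => ?_
      rw [norm_mul, norm_pow, Complex.norm_real, Real.norm_of_nonneg hr.le]
    rw [mul_left_comm, ENNReal.tsum_mul_left, ← ENNReal.tsum_mul_left]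
    congr 2
    funext n
    rw [← ENNReal.ofReal_mul (by positivity), ← ENNReal.ofReal_mul (by positivity)]
    congr 1
    rw [norm_mul, norm_pow, Complex.norm_real, Real.norm_of_nonneg hr.le]
    ring
  rw [setLIntegral_congr_fun measurableSet_Ioi hinner, lintegral_indicator measurableSet_Ioo,
    Measure.restrict_restrict measurableSet_Ioo,
    show Ioo (0 : ℝ) 1 ∩ Ioi 0 = Ioo 0 1 from inter_eq_left.2 fun x hx => hx.1,
    lintegral_tsum (fun n => by fun_prop), ← ENNReal.tsum_mul_left]
  congr 1
  funext n
  rw [lintegral_const_mul' _ _ ENNReal.ofReal_ne_top, lintegral_const_mul' _ _ ENNReal.ofReal_ne_top,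
    lintegral_radial β hβ, ← ENNReal.ofReal_mul (by positivity),
    ← ENNReal.ofReal_mul (by positivity), ← ENNReal.ofReal_mul (by positivity)]
  congr 1
  ring

theorem differentiableOn_iteratedDeriv {F : ℂ → ℂ} (hF : DifferentiableOn ℂ F (Metric.ball 0 1))
    (k : ℕ) : DifferentiableOn ℂ (iteratedDeriv k F) (Metric.ball 0 1) := by
  induction k with
  | zero => simpa using hF
  | succ k ih => rw [iteratedDeriv_succ]; exact ih.deriv Metric.isOpen_ball

theorem summable_iff_of_isTheta {u v : ℕ → ℝ} (h : u =Θ[atTop] v) : Summable u ↔ Summable v :=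
  ⟨fun hu => summable_of_isBigO_nat hu h.2, fun hv => summable_of_isBigO_nat hv h.1⟩

theorem rpow_isTheta_shift (p : ℝ) (k : ℕ) :
    (fun n : ℕ => (((n + k : ℕ) : ℝ)) ^ p) =Θ[atTop] fun n : ℕ => (n : ℝ) ^ p := by
  have h1 : (fun n : ℕ => ((n + k : ℕ) : ℝ)) =Θ[atTop] fun n : ℕ => (n : ℝ) := by
    refine IsEquivalent.isTheta ?_
    have : (fun n : ℕ => ((n + k : ℕ) : ℝ)) = (fun n : ℕ => (n : ℝ)) + fun _ => (k : ℝ) := by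
      funext n; simp
    rw [this]
    refine IsEquivalent.add_isLittleO IsEquivalent.refl ?_
    exact isLittleO_const_left.2 (Or.inr (tendsto_norm_atTop_atTop.comp tendsto_natCast_atTop_atTop))
  exact IsTheta.rpow (Eventually.of_forall fun n => by positivity)
    (Eventually.of_forall fun n => by positivity) h1

theorem factorial_isTheta_shift (k : ℕ) :
    (fun n : ℕ => ((n + k) ! : ℝ)) =Θ[atTop] fun n : ℕ => (n ! : ℝ) * (n : ℝ) ^ (k : ℝ) := by
  have := gamma_add_isTheta (k + 1) (fun n => by
    have : (0 : ℝ) ≤ n := by positivity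
    have : (0 : ℝ) ≤ k := by positivity
    linarith)
  convert this using 2 with n
  · rw [← Real.Gamma_nat_eq_factorial]; push_cast; ring_nf
  · simp


theorem iteratedDeriv_iteratedDeriv' (F : ℂ → ℂ) (j k : ℕ) :
    iteratedDeriv j (iteratedDeriv k F) = iteratedDeriv (j + k) F := by
  simp only [iteratedDeriv_eq_iterate, Function.iterate_add_apply]

/-- The square integrability in the definition of `A²_α` in terms of Taylor coefficients; in
particular it does not depend on `k`. -/
theorem memLp_iff_summable {F : ℂ → ℂ} (hF : DifferentiableOn ℂ F (Metric.ball 0 1)) (α : ℝ) (k : ℕ)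
    (hk : -1 < α + 2 * k) :
    MemLp (fun z => (1 - (‖z‖ : ℂ) ^ 2) ^ k * iteratedDeriv k F z) 2
      ((volume.restrict (Metric.ball (0 : ℂ) 1)).withDensity
        fun z => ENNReal.ofReal ((1 - ‖z‖ ^ 2) ^ α)) ↔
    Summable fun n : ℕ => ‖iteratedDeriv n F 0 / (n ! : ℂ)‖ ^ 2 * (n : ℝ) ^ (-(α + 1)) := by
  set β := α + 2 * k with hβ
  have hdk := differentiableOn_iteratedDeriv hF k
  have hcont : ContinuousOn (fun z : ℂ => (1 - (‖z‖ : ℂ) ^ 2) ^ k * iteratedDeriv k F z)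
      (Metric.ball 0 1) := ContinuousOn.mul (by fun_prop) hdk.continuousOn
  have hdens : Measurable fun z : ℂ => ENNReal.ofReal ((1 - ‖z‖ ^ 2) ^ α) := by fun_prop
  have hae : AEStronglyMeasurable (fun z : ℂ => (1 - (‖z‖ : ℂ) ^ 2) ^ k * iteratedDeriv k F z)
      (volume.restrict (Metric.ball (0 : ℂ) 1)) := hcont.aestronglyMeasurable measurableSet_ball
  have hae' := hae.mono_ac (withDensity_absolutelyContinuous _
    (fun z : ℂ => ENNReal.ofReal ((1 - ‖z‖ ^ 2) ^ α)))
  rw [MemLp, and_iff_right hae',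
    eLpNorm_lt_top_iff_lintegral_rpow_enorm_lt_top two_ne_zero ENNReal.ofNat_ne_top,
    lintegral_withDensity_eq_lintegral_mul₀ hdens.aemeasurable (hae.enorm.pow_const _)]
  have hfun : ∀ z ∈ Metric.ball (0 : ℂ) 1,
      ((fun z : ℂ => ENNReal.ofReal ((1 - ‖z‖ ^ 2) ^ α)) * fun z =>
        ‖(1 - (‖z‖ : ℂ) ^ 2) ^ k * iteratedDeriv k F z‖ₑ ^ (2 : ℝ≥0∞).toReal) z =
      ENNReal.ofReal ((1 - ‖z‖ ^ 2) ^ β) * ‖iteratedDeriv k F z‖ₑ ^ 2 := by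
    intro z hz
    have hz1 : 0 < 1 - ‖z‖ ^ 2 := by
      have := mem_ball_zero_iff.1 hz
      nlinarith [norm_nonneg z]
    have hn : ‖(1 - (‖z‖ : ℂ) ^ 2) ^ k‖ₑ = ENNReal.ofReal ((1 - ‖z‖ ^ 2) ^ k) := by
      rw [← ofReal_norm, norm_pow]
      congr 2
      have : (1 - (‖z‖ : ℂ) ^ 2) = ((1 - ‖z‖ ^ 2 : ℝ) : ℂ) := by push_cast; rfl
      rw [this, Complex.norm_real, Real.norm_of_nonneg hz1.le]
    simp only [Pi.mul_apply, ENNReal.toReal_ofNat, ENNReal.rpow_ofNat]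
    rw [enorm_mul, mul_pow, hn, ← mul_assoc, ← ENNReal.ofReal_pow (by positivity),
      ← ENNReal.ofReal_mul (by positivity), hβ, Real.rpow_add hz1]
    congr 3
    rw [← pow_mul, mul_comm k 2, ← Real.rpow_natCast]
    push_cast
    rfl
  rw [setLIntegral_congr_fun measurableSet_ball hfun, lintegral_disc hdk β hk]
  have hpi : ENNReal.ofReal π ≠ 0 := by simp [Real.pi_pos]
  have hb : ∀ n : ℕ, 0 < ProbabilityTheory.beta (n + 1) (β + 1) := fun n =>
    ProbabilityTheory.beta_pos (by positivity) (by linarith)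
  have h1 : (ENNReal.ofReal π * ∑' n : ℕ, ENNReal.ofReal
      (‖iteratedDeriv n (iteratedDeriv k F) 0 / (n ! : ℂ)‖ ^ 2 *
        ProbabilityTheory.beta (n + 1) (β + 1)) < ⊤) ↔
      Summable fun n : ℕ => ‖iteratedDeriv n (iteratedDeriv k F) 0 / (n ! : ℂ)‖ ^ 2 *
        ProbabilityTheory.beta (n + 1) (β + 1) := by
    constructor
    · intro h
      have h2 := ENNReal.lt_top_of_mul_ne_top_right h.ne hpi
      have h3 := ENNReal.summable_toReal h2.ne
      refine h3.congr fun n => ?_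
      exact ENNReal.toReal_ofReal (mul_nonneg (by positivity) (hb n).le)
    · intro h
      refine ENNReal.mul_lt_top ENNReal.ofReal_lt_top ?_
      rw [← ENNReal.ofReal_tsum_of_nonneg (fun n => mul_nonneg (by positivity) (hb n).le) h]
      exact ENNReal.ofReal_lt_top
  rw [h1, ← summable_nat_add_iff (f := fun n : ℕ =>
    ‖iteratedDeriv n F 0 / (n ! : ℂ)‖ ^ 2 * (n : ℝ) ^ (-(α + 1))) k]
  have h4 : ∀ n : ℕ, ‖iteratedDeriv n (iteratedDeriv k F) 0 / (n ! : ℂ)‖ ^ 2 *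
        ProbabilityTheory.beta (n + 1) (β + 1) =
      ‖iteratedDeriv (n + k) F 0 / ((n + k) ! : ℂ)‖ ^ 2 *
        (((n + k) ! : ℝ) ^ 2 / ((n ! : ℝ) ^ 2) * ((n ! : ℝ) * Real.Gamma (β + 1)
          * (Real.Gamma (n + (β + 2)))⁻¹)) := by
    intro n
    rw [iteratedDeriv_iteratedDeriv', norm_div, norm_div, Complex.norm_natCast,
      Complex.norm_natCast, ProbabilityTheory.beta, Real.Gamma_nat_eq_factorial]
    have : (n ! : ℝ) ≠ 0 := by positivity
    have : ((n + k) ! : ℝ) ≠ 0 := by positivity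
    rw [show (n : ℝ) + 1 + (β + 1) = n + (β + 2) by ring]
    field_simp
  simp_rw [h4]
  refine summable_iff_of_isTheta ((isTheta_refl _ _).mul ?_)
  have hG : Real.Gamma (β + 1) ≠ 0 := (Real.Gamma_pos_of_pos (by linarith)).ne'
  have t1 := factorial_isTheta_shift k
  have t2 := gamma_add_isTheta (β + 2) (fun n => by
    have : (0 : ℝ) ≤ n := by positivity
    linarith)
  have t3 := ((t1.pow 2).div (isTheta_refl (fun n : ℕ => (n ! : ℝ) ^ 2) atTop)).mul
    (((isTheta_refl (fun n : ℕ => (n ! : ℝ)) atTop).mul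
      (isTheta_const_const hG (one_ne_zero (α := ℝ)) (l := atTop))).mul t2.inv)
  refine (t3.trans_eventuallyEq ?_).trans (rpow_isTheta_shift (-(α + 1)) k).symm
  filter_upwards [eventually_gt_atTop 0] with n hn
  have hn0 : (0 : ℝ) < n := by exact_mod_cast hn
  have : (n ! : ℝ) ≠ 0 := by positivity
  have e1 : (n : ℝ) ^ (-(α + 1)) = ((n : ℝ) ^ (k : ℝ)) ^ 2 * ((n : ℝ) ^ (β + 2 - 1))⁻¹ := by
    rw [← Real.rpow_neg hn0.le, ← Real.rpow_natCast, ← Real.rpow_mul hn0.le, ← Real.rpow_add hn0]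
    congr 1
    rw [hβ]; push_cast; ring
  rw [e1]
  field_simp

theorem powerSeries_of_bounded {c : ℕ → ℂ} {F : ℂ → ℂ}
    (hc : ∀ r : ℝ, 0 ≤ r → r < 1 → Summable fun n => ‖c n‖ * r ^ n)
    (hF : ∀ z ∈ Metric.ball (0 : ℂ) 1, F z = ∑' n, c n * z ^ n) :
    DifferentiableOn ℂ F (Metric.ball 0 1) ∧ ∀ n, iteratedDeriv n F 0 / (n ! : ℂ) = c n := by
  have hrad : 1 ≤ (FormalMultilinearSeries.ofScalars ℂ c).radius := by
    refine ENNReal.le_of_forall_nnreal_lt fun r hr => ?_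
    apply FormalMultilinearSeries.le_radius_of_summable
    refine (hc r r.2 (by exact_mod_cast hr)).congr fun n => ?_
    rw [FormalMultilinearSeries.ofScalars_norm]
  have hps : HasFPowerSeriesOnBall F (FormalMultilinearSeries.ofScalars ℂ c) 0 1 := by
    refine ⟨hrad, one_pos, fun {y} hy => ?_⟩
    have hy' : y ∈ Metric.ball (0 : ℂ) 1 := by
      rw [← ENNReal.ofReal_one, Metric.eball_ofReal] at hy; exact hy
    have hs : Summable fun n => c n * y ^ n :=
      ((hc ‖y‖ (norm_nonneg _) (mem_ball_zero_iff.1 hy')).congr fun n => by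
        rw [norm_mul, norm_pow]).of_norm
    rw [zero_add, hF y hy']
    simpa [FormalMultilinearSeries.ofScalars_apply_eq, mul_comm] using hs.hasSum
  refine ⟨?_, fun n => ?_⟩
  · have := hps.differentiableOn
    rwa [← ENNReal.ofReal_one, Metric.eball_ofReal] at this
  · have h := (hps.analyticAt.hasFPowerSeriesAt).eq_formalMultilinearSeries hps.hasFPowerSeriesAt
    exact congrFun (FormalMultilinearSeries.ofScalars_series_injective ℂ ℂ h) n

end BergmanAux

noncomputable section

/-- The extension by zero to `ℂ` of a function on the open unit disc. -/
def discExtend (f : 𝔻 → ℂ) : ℂ → ℂ :=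
  Function.extend (fun z : 𝔻 => (z : ℂ)) f 0

/-- The `n`-th Taylor coefficient at `0` of a (holomorphic) function on the open unit disc. -/
def taylorCoeff (f : 𝔻 → ℂ) (n : ℕ) : ℂ :=
  iteratedDeriv n (discExtend f) 0 / (n ! : ℂ)

/-- The measure `dA_α(z) = (1 - |z|²)^α dA(z)` on the open unit disc, with `dA` the area measure. -/
def weightedArea (α : ℝ) : Measure ℂ :=
  (volume.restrict (Metric.ball (0 : ℂ) 1)).withDensity
    fun z => ENNReal.ofReal ((1 - ‖z‖ ^ 2) ^ α)

/-- `f` belongs to the weighted Bergman space `A²_α`, `α` any real number: `f` is holomorphic on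
the disc, and there is an integer `k ≥ 0` with `α + 2k > -1` such that `(1 - |z|²)^k f^{(k)}(z)`
belongs to `L²(dA_α)`. -/
def MemBergman (α : ℝ) (f : 𝔻 → ℂ) : Prop :=
  DifferentiableOn ℂ (discExtend f) (Metric.ball 0 1) ∧
    ∃ k : ℕ, -1 < α + 2 * k ∧
      MemLp (fun z : ℂ => (1 - (‖z‖ : ℂ) ^ 2) ^ k * iteratedDeriv k (discExtend f) z) 2
        (weightedArea α)

theorem discExtend_coe (f : 𝔻 → ℂ) (z : 𝔻) : discExtend f z = f z :=
  Complex.UnitDisc.coe_injective.extend_apply f 0 z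

theorem memBergman_iff {α : ℝ} {f : 𝔻 → ℂ} : MemBergman α f ↔
    DifferentiableOn ℂ (discExtend f) (Metric.ball 0 1) ∧
      Summable fun n : ℕ => ‖taylorCoeff f n‖ ^ 2 * (n : ℝ) ^ (-(α + 1)) := by
  constructor
  · rintro ⟨hd, k, hk, hm⟩
    exact ⟨hd, (BergmanAux.memLp_iff_summable hd α k hk).1 hm⟩
  · rintro ⟨hd, hs⟩
    obtain ⟨k, hk⟩ := exists_nat_gt (-1 - α)
    have hk' : -1 < α + 2 * k := by
      have : (0 : ℝ) ≤ k := by positivity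
      linarith
    exact ⟨hd, k, hk', (BergmanAux.memLp_iff_summable hd α k hk').2 hs⟩

theorem discExtend_add (f g : 𝔻 → ℂ) : discExtend (f + g) = discExtend f + discExtend g := by
  have := Function.extend_add (fun z : 𝔻 => (z : ℂ)) f g 0 0
  simpa [discExtend] using this

theorem discExtend_smul (a : ℂ) (f : 𝔻 → ℂ) : discExtend (a • f) = a • discExtend f := by
  have := Function.extend_smul a (fun z : 𝔻 => (z : ℂ)) f 0
  simpa [discExtend] using this

theorem contDiffAt_of_disc {F : ℂ → ℂ} (hF : DifferentiableOn ℂ F (Metric.ball 0 1)) (n : ℕ) :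
    ContDiffAt ℂ n F 0 :=
  (hF.analyticAt (Metric.ball_mem_nhds 0 one_pos)).contDiffAt

theorem taylorCoeff_add {f g : 𝔻 → ℂ} (hf : DifferentiableOn ℂ (discExtend f) (Metric.ball 0 1))
    (hg : DifferentiableOn ℂ (discExtend g) (Metric.ball 0 1)) (n : ℕ) :
    taylorCoeff (f + g) n = taylorCoeff f n + taylorCoeff g n := by
  rw [taylorCoeff, discExtend_add, iteratedDeriv_add (contDiffAt_of_disc hf n)
    (contDiffAt_of_disc hg n), add_div]
  rfl

theorem taylorCoeff_smul (a : ℂ) (f : 𝔻 → ℂ) (n : ℕ) :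
    taylorCoeff (a • f) n = a * taylorCoeff f n := by
  rw [taylorCoeff, discExtend_smul, iteratedDeriv_const_smul_field, smul_eq_mul, mul_div_assoc]
  rfl

/-- The weighted Bergman space `A²_α` as a vector space of functions on the disc. -/
def bergmanSubmodule (α : ℝ) : Submodule ℂ (𝔻 → ℂ) where
  carrier := {f | MemBergman α f}
  zero_mem' := by
    refine memBergman_iff.2 ?_
    have h0 : discExtend 0 = 0 := by simpa using discExtend_smul 0 0
    have h1 : ∀ n, taylorCoeff 0 n = 0 := fun n => by simpa using taylorCoeff_smul 0 0 n
    rw [h0]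
    exact ⟨differentiableOn_const 0, by simp [h1, summable_zero]⟩
  add_mem' := by
    intro f g hf hg
    obtain ⟨hfd, hfs⟩ := memBergman_iff.1 hf
    obtain ⟨hgd, hgs⟩ := memBergman_iff.1 hg
    refine memBergman_iff.2 ⟨by rw [discExtend_add]; exact hfd.add hgd, ?_⟩
    refine Summable.of_nonneg_of_le (fun n => by positivity) (fun n => ?_)
      ((hfs.add hgs).mul_left 2)
    rw [taylorCoeff_add hfd hgd, ← add_mul, ← mul_assoc]
    refine mul_le_mul_of_nonneg_right ?_ (by positivity)
    have := norm_add_le (taylorCoeff f n) (taylorCoeff g n)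
    nlinarith [norm_nonneg (taylorCoeff f n + taylorCoeff g n),
      sq_nonneg (‖taylorCoeff f n‖ - ‖taylorCoeff g n‖)]
  smul_mem' := by
    intro a f hf
    obtain ⟨hfd, hfs⟩ := memBergman_iff.1 hf
    refine memBergman_iff.2 ⟨by rw [discExtend_smul]; exact hfd.const_smul a, ?_⟩
    refine (hfs.mul_left (‖a‖ ^ 2)).congr fun n => ?_
    rw [taylorCoeff_smul, norm_mul]
    ring

/-- The least integer `N ≥ 0` with `-N ≤ α + 2`: it is `0` if `α + 2 > 0`, and it is the positive
integer with `-N < α + 2 < -N + 1` if `α + 2` is negative and not an integer. -/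
def bergmanOrder (α : ℝ) : ℕ := ⌈-(α + 2)⌉₊

/-- The `n`-th Taylor coefficient of `x ↦ (-1)^N (1 - x)^{-(α+2)} + Q(x)`. -/
def kernelCoeff (α : ℝ) (Q : Polynomial ℝ) (n : ℕ) : ℝ :=
  (-1) ^ bergmanOrder α * (Real.Gamma (n + (α + 2)) / ((n ! : ℝ) * Real.Gamma (α + 2))) + Q.coeff n

/-- A choice of the polynomial `Q` in the reproducing kernel
`K(z, w) = (-1)^N (1 - z * conj w)^{-(α+2)} + Q(z * conj w)` of `A²_α`, `α + 2` not an integer `≤ 0`. It vanishes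
if `α + 2 > 0`. It has degree at most `N`, and it makes all Taylor coefficients of the kernel
positive, as they are the numbers `1 / ‖zⁿ‖²`. -/
structure BergmanKernel (α : ℝ) where
  /-- the polynomial -/
  Q : Polynomial ℝ
  natDegree_le : Q.natDegree ≤ bergmanOrder α
  eq_zero_of_pos : 0 < α + 2 → Q = 0
  coeff_pos : ∀ n : ℕ, 0 < kernelCoeff α Q n

variable {α : ℝ}

/-- The weights `κ_n = 1 / ‖zⁿ‖²`. -/
def BergmanKernel.coeff (K : BergmanKernel α) (n : ℕ) : ℝ := kernelCoeff α K.Q n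

/-- The kernel function `K(z, w) = (-1)^N (1 - z * conj w)^{-(α+2)} + Q(z * conj w)`. -/
def BergmanKernel.toFun (K : BergmanKernel α) (z w : 𝔻) : ℂ :=
  (-1) ^ bergmanOrder α * (1 - (z : ℂ) * conj (w : ℂ)) ^ (-((α : ℂ) + 2)) +
    Polynomial.aeval ((z : ℂ) * conj (w : ℂ)) K.Q

theorem BergmanKernel.ne_neg_nat (K : BergmanKernel α) (m : ℕ) : α + 2 ≠ -(m : ℝ) := by
  intro h
  have hN : bergmanOrder α = m := by rw [bergmanOrder, h]; simp
  have h1 := K.coeff_pos (m + 1)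
  have h2 : K.Q.coeff (m + 1) = 0 :=
    Polynomial.coeff_eq_zero_of_natDegree_lt (by have := K.natDegree_le; omega)
  rw [kernelCoeff, h2, h, Real.Gamma_neg_nat_eq_zero] at h1
  simp at h1

theorem BergmanKernel.coeff_isTheta (K : BergmanKernel α) :
    K.coeff =Θ[atTop] fun n : ℕ => (n : ℝ) ^ (α + 1) := by
  have hG : Real.Gamma (α + 2) ≠ 0 := Real.Gamma_ne_zero K.ne_neg_nat
  have h1 := BergmanAux.gamma_add_isTheta (α + 2) K.ne_neg_nat
  have hu : ((-1) ^ bergmanOrder α / Real.Gamma (α + 2) : ℝ) ≠ 0 :=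
    div_ne_zero (pow_ne_zero _ (by norm_num)) hG
  have h2 := (isTheta_const_const hu (one_ne_zero (α := ℝ)) (l := (atTop : Filter ℕ))).mul
    (h1.mul (isTheta_refl (fun n : ℕ => ((n ! : ℝ))⁻¹) atTop))
  refine (EventuallyEq.trans_isTheta ?_ h2).trans_eventuallyEq ?_
  · filter_upwards [eventually_gt_atTop (bergmanOrder α)] with n hn
    have hQ : K.Q.coeff n = 0 :=
      Polynomial.coeff_eq_zero_of_natDegree_lt (lt_of_le_of_lt K.natDegree_le hn)
    rw [BergmanKernel.coeff, kernelCoeff, hQ]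
    field_simp
    ring
  · filter_upwards with n
    have : (n ! : ℝ) ≠ 0 := by positivity
    rw [show α + 2 - 1 = α + 1 by ring]
    field_simp

theorem BergmanKernel.memBergman_iff (K : BergmanKernel α) {f : 𝔻 → ℂ} : MemBergman α f ↔
    DifferentiableOn ℂ (discExtend f) (Metric.ball 0 1) ∧
      Summable fun n : ℕ => ‖taylorCoeff f n‖ ^ 2 / K.coeff n := by
  rw [_root_.memBergman_iff]
  refine and_congr_right fun _ => ?_
  refine BergmanAux.summable_iff_of_isTheta ?_
  simp_rw [div_eq_mul_inv]
  refine (isTheta_refl _ _).mul (EventuallyEq.trans_isTheta ?_ K.coeff_isTheta.inv.symm)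
  filter_upwards with n
  rw [Real.rpow_neg (by positivity)]

theorem BergmanKernel.coeff_mul_geometric (K : BergmanKernel α) {r : ℝ} (h0 : 0 ≤ r) (h1 : r < 1) :
    Summable fun n => K.coeff n * r ^ n := by
  obtain ⟨m, hm⟩ := exists_nat_gt (α + 1)
  have hs := summable_pow_mul_geometric_of_norm_lt_one m (r := r)
    (by rwa [Real.norm_of_nonneg h0])
  refine summable_of_isBigO_nat hs (IsBigO.mul (K.coeff_isTheta.1.trans ?_) (isBigO_refl _ _))
  refine IsBigO.of_bound 1 ?_
  filter_upwards [eventually_ge_atTop 1] with n hn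
  have hn1 : (1 : ℝ) ≤ n := by exact_mod_cast hn
  rw [one_mul, Real.norm_of_nonneg (by positivity), Real.norm_of_nonneg (by positivity),
    ← Real.rpow_natCast]
  exact Real.rpow_le_rpow_of_exponent_le hn1 hm.le

/-- The space `A²_α` with the Hilbert space structure that has the reproducing kernel `K`. -/
def BergmanSpace (_K : BergmanKernel α) : Type := bergmanSubmodule α

namespace BergmanSpace

variable (K : BergmanKernel α)

instance : AddCommGroup (BergmanSpace K) := inferInstanceAs (AddCommGroup (bergmanSubmodule α))

instance : Module ℂ (BergmanSpace K) := inferInstanceAs (Module ℂ (bergmanSubmodule α))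

variable {K}

instance : CoeFun (BergmanSpace K) fun _ => 𝔻 → ℂ := ⟨fun f => f.1⟩

theorem memBergman (f : BergmanSpace K) : MemBergman α f := f.2

theorem hasSum (f : BergmanSpace K) (z : 𝔻) :
    HasSum (fun n : ℕ => taylorCoeff f n * (z : ℂ) ^ n) (f z) := by
  have := BergmanAux.coeff_hasSum f.memBergman.1 (mem_ball_zero_iff.2 z.norm_lt_one)
  rwa [discExtend_coe] at this

theorem ext_coeff {f g : BergmanSpace K} (h : ∀ n, taylorCoeff f n = taylorCoeff g n) : f = g := by
  refine Subtype.ext (funext fun z => ?_)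
  have h1 := f.hasSum z
  simp_rw [h] at h1
  exact h1.unique (g.hasSum z)

theorem exists_of_coeff (c : ℕ → ℂ) (hc : Summable fun n => ‖c n‖ ^ 2 / K.coeff n) :
    ∃ f : BergmanSpace K, ∀ n, taylorCoeff f n = c n := by
  have hps : ∀ r : ℝ, 0 ≤ r → r < 1 → Summable fun n => ‖c n‖ * r ^ n := by
    intro r h0 h1
    have hs := K.coeff_mul_geometric (r := r ^ 2) (by positivity) (by nlinarith)
    refine Summable.of_nonneg_of_le (fun n => by positivity) (fun n => ?_) (hc.add hs)
    have hk : 0 < K.coeff n := K.coeff_pos n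
    have e : ‖c n‖ ^ 2 / K.coeff n + K.coeff n * (r ^ 2) ^ n - 2 * (‖c n‖ * r ^ n) =
        (‖c n‖ - K.coeff n * r ^ n) ^ 2 / K.coeff n := by
      field_simp
      ring
    have h2 : 0 ≤ (‖c n‖ - K.coeff n * r ^ n) ^ 2 / K.coeff n := by positivity
    have h3 : 0 ≤ ‖c n‖ * r ^ n := by positivity
    linarith
  obtain ⟨hd, hcoef⟩ := BergmanAux.powerSeries_of_bounded (c := c)
    (F := discExtend fun z : 𝔻 => ∑' n, c n * (z : ℂ) ^ n) hps (fun z hz => by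
      have := discExtend_coe (fun z : 𝔻 => ∑' n, c n * (z : ℂ) ^ n)
        (Complex.UnitDisc.mk z (mem_ball_zero_iff.1 hz))
      simpa using this)
  refine ⟨⟨fun z : 𝔻 => ∑' n, c n * (z : ℂ) ^ n, K.memBergman_iff.2 ⟨hd, ?_⟩⟩, hcoef⟩
  refine hc.congr fun n => ?_
  rw [← hcoef n]
  rfl

/-- The normalized Taylor coefficients `a_n(f) / √κ_n`. -/
def coeffLp (f : BergmanSpace K) : lp (fun _ : ℕ => ℂ) 2 :=
  ⟨fun n => taylorCoeff f n / (√(K.coeff n) : ℝ), by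
    refine memℓp_gen ((K.memBergman_iff.1 f.memBergman).2.congr fun n => ?_)
    have hk : 0 < K.coeff n := K.coeff_pos n
    rw [ENNReal.toReal_ofNat, Real.rpow_ofNat, norm_div, Complex.norm_real,
      Real.norm_of_nonneg (Real.sqrt_nonneg _), div_pow, Real.sq_sqrt hk.le]⟩

/-- The normalized Taylor coefficients, as a linear equivalence of `A²_α` with `ℓ²`. -/
def coeffEquiv (K : BergmanKernel α) : BergmanSpace K ≃ₗ[ℂ] lp (fun _ : ℕ => ℂ) 2 :=
  LinearEquiv.ofBijective
    { toFun := coeffLp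
      map_add' := fun f g => by
        ext n
        have := taylorCoeff_add f.memBergman.1 g.memBergman.1 n
        change taylorCoeff (f.1 + g.1) n / _ = _ + _
        rw [this, add_div]
        rfl
      map_smul' := fun a f => by
        ext n
        have := taylorCoeff_smul a f n
        change taylorCoeff (a • f.1) n / _ = a * _
        rw [this, mul_div_assoc]
        rfl }
    (by
      have hsq : ∀ n, ((√(K.coeff n) : ℝ) : ℂ) ≠ 0 := fun n =>
        Complex.ofReal_ne_zero.2 (Real.sqrt_pos.2 (K.coeff_pos n)).ne'
      constructor
      · intro f g h
        refine ext_coeff fun n => ?_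
        have := congrFun (congrArg Subtype.val h) n
        exact (div_left_inj' (hsq n)).1 this
      · intro x
        have hx := (lp.memℓp x).summable (by norm_num)
        obtain ⟨f, hf⟩ := exists_of_coeff (K := K) (fun n => x n * (√(K.coeff n) : ℝ)) (by
          refine hx.congr fun n => ?_
          have hk : 0 < K.coeff n := K.coeff_pos n
          rw [ENNReal.toReal_ofNat, Real.rpow_ofNat, norm_mul, Complex.norm_real,
            Real.norm_of_nonneg (Real.sqrt_nonneg _), mul_pow, Real.sq_sqrt hk.le]
          field_simp)
        refine ⟨f, ?_⟩
        ext n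
        change taylorCoeff f n / _ = _
        rw [hf, mul_div_cancel_right₀ _ (hsq n)])

theorem coeffEquiv_apply (f : BergmanSpace K) (n : ℕ) :
    coeffEquiv K f n = taylorCoeff f n / (√(K.coeff n) : ℝ) := rfl

theorem inner_coeffEquiv (f g : BergmanSpace K) :
    inner ℂ (coeffEquiv K f) (coeffEquiv K g) =
      ∑' n : ℕ, conj (taylorCoeff f n) * taylorCoeff g n / K.coeff n := by
  rw [lp.inner_eq_tsum]
  congr 1
  funext n
  have hk : 0 < K.coeff n := K.coeff_pos n
  have h2 : ((K.coeff n : ℝ) : ℂ) = (√(K.coeff n) : ℝ) * (√(K.coeff n) : ℝ) := by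
    rw [← Complex.ofReal_mul, Real.mul_self_sqrt hk.le]
  rw [coeffEquiv_apply, coeffEquiv_apply, RCLike.inner_apply, map_div₀, Complex.conj_ofReal, h2,
    div_mul_div_comm, mul_comm (taylorCoeff g n)]

/-- The inner product `⟨f, g⟩ = ∑ conj(a_n(f)) a_n(g) / κ_n` on `A²_α`, conjugate-linear in the
first variable: the monomials are orthogonal, with `‖zⁿ‖² = 1 / κ_n`. -/
@[reducible] def innerCore (K : BergmanKernel α) : InnerProductSpace.Core ℂ (BergmanSpace K) where
  inner f g := ∑' n : ℕ, conj (taylorCoeff f n) * taylorCoeff g n / K.coeff n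
  conj_inner_symm f g := by simp only [← inner_coeffEquiv, inner_conj_symm]
  re_inner_nonneg f := by simp only [← inner_coeffEquiv]; exact inner_self_nonneg
  add_left f g h := by simp only [← inner_coeffEquiv, map_add, inner_add_left]
  smul_left f g a := by simp only [← inner_coeffEquiv, map_smul, inner_smul_left]
  definite f h := by
    simp only [← inner_coeffEquiv] at h
    exact (coeffEquiv K).map_eq_zero_iff.1 (inner_self_eq_zero.1 h)

instance : NormedAddCommGroup (BergmanSpace K) := (innerCore K).toNormedAddCommGroup

instance : InnerProductSpace ℂ (BergmanSpace K) := InnerProductSpace.ofCore (innerCore K).toCore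

theorem inner_eq (f g : BergmanSpace K) :
    inner ℂ f g = ∑' n : ℕ, conj (taylorCoeff f n) * taylorCoeff g n / K.coeff n := rfl

/-- `coeffEquiv` is an isometry. -/
def coeffIsometry (K : BergmanKernel α) : BergmanSpace K ≃ₗᵢ[ℂ] lp (fun _ : ℕ => ℂ) 2 :=
  (coeffEquiv K).isometryOfInner fun f g => by rw [inner_coeffEquiv, inner_eq]

instance : CompleteSpace (BergmanSpace K) :=
  (coeffIsometry K).toIsometryEquiv.isometry.isUniformInducing.completeSpace_congr
    (coeffIsometry K).surjective |>.2 inferInstance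

theorem kernel_hasSum (K : BergmanKernel α) (z w : 𝔻) :
    HasSum (fun n : ℕ => (K.coeff n : ℂ) * ((z : ℂ) * conj (w : ℂ)) ^ n) (K.toFun z w) := by
  set x : ℂ := (z : ℂ) * conj (w : ℂ) with hx
  have hx1 : ‖x‖ < 1 := by
    rw [hx, norm_mul, RCLike.norm_conj]
    exact mul_lt_one_of_nonneg_of_lt_one_left (norm_nonneg _) z.norm_lt_one w.norm_lt_one.le
  have h1 := (Complex.one_div_one_sub_cpow_hasFPowerSeriesOnBall_zero ((α : ℂ) + 2)).hasSum
    (y := x) (by rw [← ENNReal.ofReal_one, Metric.eball_ofReal]; simpa using hx1)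
  have hcoef : ∀ n : ℕ, Ring.choose ((α : ℂ) + 2 + n - 1) n =
      ((Real.Gamma (n + (α + 2)) / ((n ! : ℝ) * Real.Gamma (α + 2)) : ℝ) : ℂ) := by
    intro n
    have hne : ∀ k : ℕ, (α : ℂ) + 2 ≠ -k := fun k h => K.ne_neg_nat k (by exact_mod_cast h)
    have h3 := Complex.Gamma_add_nat_div_Gamma_eq (n := n) ((α : ℂ) + 2) hne
    have h4 := Ring.factorial_nsmul_multichoose_eq_ascPochhammer ((α : ℂ) + 2) n
    rw [Ring.choose, show (α : ℂ) + 2 + n - 1 - n + 1 = α + 2 by ring]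
    rw [Polynomial.ascPochhammer_smeval_eq_eval, ← h3, nsmul_eq_mul] at h4
    have hf : (n ! : ℂ) ≠ 0 := by exact_mod_cast n.factorial_ne_zero
    have h5 : Complex.Gamma ((α : ℂ) + 2) ≠ 0 := Complex.Gamma_ne_zero hne
    push_cast
    rw [← Complex.Gamma_ofReal, ← Complex.Gamma_ofReal]
    push_cast
    rw [add_comm (n : ℂ), mul_comm (n ! : ℂ), ← div_div, ← h4]
    field_simp
  have h2 : HasSum (fun n : ℕ =>
      ((Real.Gamma (n + (α + 2)) / ((n ! : ℝ) * Real.Gamma (α + 2)) : ℝ) : ℂ) * x ^ n)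
      ((1 - x) ^ (-((α : ℂ) + 2))) := by
    rw [Complex.cpow_neg, ← one_div]
    simpa only [FormalMultilinearSeries.ofScalars_apply_eq, hcoef, zero_add, smul_eq_mul] using h1
  have h3 : HasSum (fun n : ℕ => ((K.Q.coeff n : ℝ) : ℂ) * x ^ n) (Polynomial.aeval x K.Q) := by
    rw [Polynomial.aeval_eq_sum_range]
    simp_rw [Algebra.smul_def]
    refine hasSum_sum_of_ne_finset_zero fun n hn => ?_
    have : K.Q.coeff n = 0 := Polynomial.coeff_eq_zero_of_natDegree_lt (by simpa using hn)
    rw [this]; simp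
  have h4 := (h2.mul_left ((-1) ^ bergmanOrder α)).add h3
  have e : ∀ n : ℕ, (K.coeff n : ℂ) * x ^ n = (-1) ^ bergmanOrder α *
      (((Real.Gamma (n + (α + 2)) / ((n ! : ℝ) * Real.Gamma (α + 2)) : ℝ) : ℂ) * x ^ n) +
        ((K.Q.coeff n : ℝ) : ℂ) * x ^ n := fun n => by
    rw [BergmanKernel.coeff, kernelCoeff]
    push_cast
    ring
  simp_rw [e]
  exact h4

/-- `K` is the reproducing kernel of the space. -/
theorem reproducing (K : BergmanKernel α) (w : 𝔻) :
    ∃ k : BergmanSpace K, (∀ z, k z = K.toFun z w) ∧ ∀ f : BergmanSpace K, inner ℂ k f = f w := by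
  obtain ⟨k, hk⟩ := exists_of_coeff (K := K) (fun n => (K.coeff n : ℂ) * conj (w : ℂ) ^ n) (by
    have := K.coeff_mul_geometric (r := ‖(w : ℂ)‖ ^ 2) (by positivity) w.sq_norm_lt_one
    refine this.congr fun n => ?_
    have hk : 0 < K.coeff n := K.coeff_pos n
    rw [norm_mul, norm_pow, RCLike.norm_conj, Complex.norm_real, Real.norm_of_nonneg hk.le]
    field_simp
    ring)
  refine ⟨k, fun z => ?_, fun f => ?_⟩
  · have h1 := k.hasSum z
    simp_rw [hk] at h1
    refine h1.unique ?_
    have e : ∀ n : ℕ, (K.coeff n : ℂ) * conj (w : ℂ) ^ n * (z : ℂ) ^ n =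
        (K.coeff n : ℂ) * ((z : ℂ) * conj (w : ℂ)) ^ n := fun n => by ring
    simp_rw [e]
    exact kernel_hasSum K z w
  · rw [inner_eq, ← (f.hasSum w).tsum_eq]
    congr 1
    funext n
    have hk0 : (K.coeff n : ℂ) ≠ 0 := Complex.ofReal_ne_zero.2 (K.coeff_pos n).ne'
    rw [hk, map_mul, map_pow, Complex.conj_conj, Complex.conj_ofReal]
    field_simp

end BergmanSpace

/-- Such kernels exist for every admissible `α`. -/
theorem BergmanKernel.nonempty (hα : ∀ m : ℕ, α + 2 ≠ -(m : ℝ)) : Nonempty (BergmanKernel α) := by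
  set N := bergmanOrder α with hN
  have hG : Real.Gamma (α + 2) ≠ 0 := Real.Gamma_ne_zero hα
  have hlt : -(N : ℝ) < α + 2 := by
    have h1 : -(α + 2) ≤ N := Nat.le_ceil _
    exact lt_of_le_of_ne (by linarith) (hα N).symm
  have hneg : ∀ j : ℕ, j < N → α + 2 + j < 0 := fun j hj => by
    have : (j : ℝ) < -(α + 2) := Nat.lt_ceil.1 hj
    linarith
  have hsign : 0 < (-1) ^ N * Real.Gamma (α + 2) := by
    have h : ∀ j : ℕ, j ≤ N →
        0 < ((-1) ^ j * Real.Gamma (α + 2)) * Real.Gamma (j + (α + 2)) := by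
      intro j hj
      induction j with
      | zero => simpa using mul_self_pos.2 hG
      | succ j ih =>
        have h1 := ih (by omega)
        have h2 := hneg j (by omega)
        have h3 : Real.Gamma (((j + 1 : ℕ) : ℝ) + (α + 2)) =
            (j + (α + 2)) * Real.Gamma (j + (α + 2)) := by
          rw [← Real.Gamma_add_one (by linarith)]
          congr 1; push_cast; ring
        rw [h3]
        have h4 : (-1) ^ (j + 1) * Real.Gamma (α + 2) *
            ((j + (α + 2)) * Real.Gamma (j + (α + 2))) =
            -(α + 2 + j) * (((-1) ^ j * Real.Gamma (α + 2)) * Real.Gamma (j + (α + 2))) := by ring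
        rw [h4]
        exact mul_pos (by linarith) h1
    have h2 : 0 < Real.Gamma (N + (α + 2)) := Real.Gamma_pos_of_pos (by linarith)
    exact pos_of_mul_pos_left (h N le_rfl) h2.le
  have hbig : ∀ n : ℕ, N ≤ n →
      0 < (-1) ^ N * (Real.Gamma (n + (α + 2)) / ((n ! : ℝ) * Real.Gamma (α + 2))) := by
    intro n hn
    have h1 : (N : ℝ) ≤ n := by exact_mod_cast hn
    have h2 : 0 < Real.Gamma (n + (α + 2)) := Real.Gamma_pos_of_pos (by linarith)
    have h3 : (-1) ^ N * (Real.Gamma (n + (α + 2)) / ((n ! : ℝ) * Real.Gamma (α + 2))) =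
        ((-1) ^ N * Real.Gamma (α + 2)) * (Real.Gamma (n + (α + 2)) /
          ((n ! : ℝ) * Real.Gamma (α + 2) ^ 2)) := by field_simp
    rw [h3]
    positivity
  set q : ℕ → ℝ := fun n => 1 +
    |(-1) ^ N * (Real.Gamma (n + (α + 2)) / ((n ! : ℝ) * Real.Gamma (α + 2)))| with hq
  set Q : Polynomial ℝ := ∑ n ∈ Finset.range N, Polynomial.monomial n (q n) with hQ
  have hc : ∀ n, Q.coeff n = if n < N then q n else 0 := fun n => by
    simp [hQ, Polynomial.coeff_monomial]
  refine ⟨⟨Q, ?_, fun h => ?_, fun n => ?_⟩⟩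
  · rw [Polynomial.natDegree_le_iff_coeff_eq_zero]
    intro n hn
    rw [hc, if_neg (by omega)]
  · have : N = 0 := Nat.ceil_eq_zero.2 (by linarith)
    rw [hQ, this]; simp
  · rw [kernelCoeff, hc]
    split_ifs with h
    · have := neg_abs_le ((-1) ^ N * (Real.Gamma (n + (α + 2)) / ((n ! : ℝ) * Real.Gamma (α + 2))))
      simp only [hq]
      linarith
    · rw [add_zero]; exact hbig n (by omega)

end

end

/-! ### Linear fractional self-maps of the disc and the Kreĭn adjoint. -/

section

open Complex Metric

namespace LinearFractional

variable {a b c d : ℂ}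

/-! The adjoint of a bounded operator `f ↦ G · (f ∘ ρ)` sends the kernel function `k_w` to `conj (G
w) • k_{ρ w}` (`adjoint_kernelAt`). So `C_φ* k_w = k_{φ w}`, while `M_g C_σ M_h* k_w = conj (h w) ·
g · (k_w ∘ σ)`. The two are compared through the identity `(-b̄z + d̄)(1 - σ(z) w̄) = conj (cw + d)
(1 - z conj (φ w))`. Its continuous logarithms on the connected space `𝔻 × 𝔻` agree at the origin by
the choice of branches, so it may be raised to the power `-(α + 2)` without a spurious factor
(`LinearFractional.exp_mul_cpow`). The principal parts of the kernels therefore cancel, and the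
difference `T` of the two operators satisfies `T k_w (z) = Q(z conj (φ w)) - g(z) conj (h w) Q(σ(z)
w̄)`. For every `w` this lies in the span of the finitely many functions `z^j` and `g σ^j` with `j ≤
deg Q`. Kernel functions span a dense subspace and finite-dimensional subspaces are closed, so the
whole range of `T` lies in that span (`map_mem_of_map_kernelAt_mem`); if `Q = 0`, then `T = 0`.

Boundedness follows from the closed graph theorem once each operator maps `A²_α` into itself. For `α
≥ 0` this is a change of variables combined with the bound `1 - |z|² ≤ const · (1 - |τ z|²)` from
`exists_lower_bound`. For other `α` it follows by induction, since `f ∈ A²_α` exactly when `f' ∈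
A²_{α+2}` and `(F · f∘τ)' = F' · f∘τ + F τ' · f'∘τ`. The weights `g`, `h` and `τ'` cause no trouble
because the denominators have no zeros on the closed disc. -/

theorem norm_le_norm_of_closedBall (h : ∀ z ∈ ball (0 : ℂ) 1, ‖a * z + b‖ < ‖c * z + d‖) {z : ℂ}
    (hz : ‖z‖ ≤ 1) : ‖a * z + b‖ ≤ ‖c * z + d‖ := by
  have hcl : IsClosed {z : ℂ | ‖a * z + b‖ ≤ ‖c * z + d‖} :=
    isClosed_le (by fun_prop) (by fun_prop)
  have hsub : ball (0 : ℂ) 1 ⊆ {z : ℂ | ‖a * z + b‖ ≤ ‖c * z + d‖} := fun w hw => (h w hw).le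
  have := hcl.closure_subset_iff.2 hsub
  rw [closure_ball (0 : ℂ) one_ne_zero] at this
  exact this (mem_closedBall_zero_iff.2 hz)

/-- Otherwise the zero `-d/c` of the denominator lies in the closed disc, where the inequality
persists by continuity. The numerator then vanishes there too, which forces the determinant to be
zero. The conclusion keeps the pole off the closed disc. -/
theorem norm_lt_norm_of_det_ne_zero (hdet : a * d - b * c ≠ 0)
    (h : ∀ z ∈ ball (0 : ℂ) 1, ‖a * z + b‖ < ‖c * z + d‖) : ‖c‖ < ‖d‖ := by
  by_contra! hcd
  have hc : c ≠ 0 := by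
    rintro rfl
    have : d = 0 := by simpa using hcd
    simp [this] at hdet
  have hz : ‖-d / c‖ ≤ 1 := by
    rw [norm_div, norm_neg]
    exact div_le_one_of_le₀ hcd (norm_nonneg _)
  have h1 := norm_le_norm_of_closedBall h hz
  have h2 : c * (-d / c) + d = 0 := by field_simp; ring
  rw [h2, norm_zero, norm_le_zero_iff] at h1
  apply hdet
  field_simp at h1
  linear_combination -h1

/-- The Kreĭn adjoint of a linear fractional self-map of the disc is a self-map of the disc. -/
theorem norm_adjoint_lt (hdet : a * d - b * c ≠ 0)
    (h : ∀ z ∈ ball (0 : ℂ) 1, ‖a * z + b‖ < ‖c * z + d‖) {z : ℂ} (hz : ‖z‖ < 1) :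
    ‖conj a * z - conj c‖ < ‖-conj b * z + conj d‖ := by
  by_contra! hle
  have e1 : ‖conj a * z - conj c‖ = ‖a * conj z - c‖ := by
    rw [← RCLike.norm_conj]; simp
  have e2 : ‖-conj b * z + conj d‖ = ‖d - b * conj z‖ := by
    rw [← RCLike.norm_conj]; congr 1; simp; ring
  rw [e1, e2] at hle
  set w := conj z with hw
  have hw1 : ‖w‖ < 1 := by rwa [hw, RCLike.norm_conj]
  have hden : a * w - c ≠ 0 := by
    intro h0
    rw [h0, norm_zero, norm_le_zero_iff] at hle
    exact hdet (by linear_combination a * hle + b * h0)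
  -- This point is `1 / conj (σ z)`, and formally `φ` maps it to `1 / conj z`: the adjoint is `φ⁻¹`
  -- conjugated by reflection in the unit circle. If `σ z` were not in the open disc, `φ` would send
  -- a point of the closed disc outside it.
  have hζ : ‖(d - b * w) / (a * w - c)‖ ≤ 1 := by
    rw [norm_div]
    exact div_le_one_of_le₀ hle (norm_nonneg _)
  have h1 := norm_le_norm_of_closedBall h hζ
  have e3 : a * ((d - b * w) / (a * w - c)) + b = (a * d - b * c) / (a * w - c) := by
    field_simp; ring
  have e4 : c * ((d - b * w) / (a * w - c)) + d = w * ((a * d - b * c) / (a * w - c)) := by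
    rw [mul_div_assoc', mul_div_assoc', div_add' _ _ _ hden]
    congr 1
    ring
  rw [e3, e4, norm_mul] at h1
  have h2 : 0 < ‖(a * d - b * c) / (a * w - c)‖ := norm_pos_iff.2 (div_ne_zero hdet hden)
  nlinarith

theorem exists_radius (hcd : ‖c‖ < ‖d‖) : ∃ R : ℝ, 1 < R ∧ ∀ z ∈ ball (0 : ℂ) R, ‖c * z‖ < ‖d‖ := by
  by_cases hc : c = 0
  · exact ⟨2, by norm_num, fun z _ => by simpa [hc] using hcd⟩
  · have hc' : 0 < ‖c‖ := norm_pos_iff.2 hc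
    refine ⟨‖d‖ / ‖c‖, by rwa [one_lt_div hc'], fun z hz => ?_⟩
    rw [mem_ball_zero_iff, lt_div_iff₀ hc'] at hz
    rwa [norm_mul, mul_comm]

theorem sq_norm_sub_sq_norm (z : ℂ) : ‖c * z + d‖ ^ 2 - ‖a * z + b‖ ^ 2 =
    (‖c‖ ^ 2 - ‖a‖ ^ 2) * ‖z‖ ^ 2 + 2 * ((c * conj d - a * conj b) * z).re +
      (‖d‖ ^ 2 - ‖b‖ ^ 2) := by
  simp only [← normSq_eq_norm_sq, normSq_apply, add_re, add_im, mul_re, mul_im, sub_re, sub_im,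
    conj_re, conj_im]
  ring

/-- Up to a factor 4, this is the discriminant of the real quadratic obtained from
`sq_norm_sub_sq_norm` along the ray on which it is smallest. It is positive when the map is
nondegenerate. -/
theorem sq_norm_coeff_sub : ‖c * conj d - a * conj b‖ ^ 2 -
    (‖c‖ ^ 2 - ‖a‖ ^ 2) * (‖d‖ ^ 2 - ‖b‖ ^ 2) = ‖a * d - b * c‖ ^ 2 := by
  simp only [← normSq_eq_norm_sq, normSq_apply, mul_re, mul_im, sub_re, sub_im, conj_re, conj_im]
  ring

/-- A Schwarz–Pick type lower bound. -/
theorem exists_lower_bound (hdet : a * d - b * c ≠ 0)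
    (h : ∀ z ∈ ball (0 : ℂ) 1, ‖a * z + b‖ < ‖c * z + d‖) :
    ∃ m : ℝ, 0 < m ∧ ∀ z ∈ ball (0 : ℂ) 1,
      m * (1 - ‖z‖ ^ 2) ≤ ‖c * z + d‖ ^ 2 - ‖a * z + b‖ ^ 2 := by
  have hB := sq_norm_coeff_sub (a := a) (b := b) (c := c) (d := d)
  have hdet' : 0 < ‖a * d - b * c‖ ^ 2 := by positivity
  set B := c * conj d - a * conj b with hBdef
  set C := ‖c‖ ^ 2 - ‖a‖ ^ 2
  set D := ‖d‖ ^ 2 - ‖b‖ ^ 2 with hD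
  have hD0 : 0 < D := by
    have := h 0 (by simp)
    simp only [mul_zero, zero_add] at this
    nlinarith [norm_nonneg b]
  -- The direction `e` makes the linear term `2 Re(Bz)` as negative as possible, which reduces the
  -- problem to a quadratic in `r = |z|`.
  obtain ⟨e, he, hBe⟩ : ∃ e : ℂ, ‖e‖ = 1 ∧ B * e = -(‖B‖ : ℂ) := by
    by_cases hB0 : B = 0
    · exact ⟨1, by simp, by simp [hB0]⟩
    · have hn : (‖B‖ : ℂ) ≠ 0 := by simpa using hB0
      refine ⟨-conj B / ‖B‖, ?_, ?_⟩
      · rw [norm_div, norm_neg, RCLike.norm_conj, norm_real, norm_norm,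
          div_self (norm_ne_zero_iff.2 hB0)]
      · rw [mul_div_assoc', mul_neg, mul_conj']
        field_simp
  have hray : ∀ r : ℝ, 0 ≤ r → ‖c * (r * e) + d‖ ^ 2 - ‖a * (r * e) + b‖ ^ 2 =
      C * r ^ 2 - 2 * ‖B‖ * r + D := by
    intro r hr
    have : B * (r * e) = ((-(‖B‖ * r) : ℝ) : ℂ) := by
      push_cast
      linear_combination (r : ℂ) * hBe
    rw [sq_norm_sub_sq_norm, ← hBdef, this, ofReal_re, norm_mul, he, norm_real,
      Real.norm_of_nonneg hr]
    ring
  have hne : ∀ r : ℝ, 0 ≤ r → ‖(r : ℂ) * e‖ = r := fun r hr => by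
    rw [norm_mul, he, norm_real, Real.norm_of_nonneg hr, mul_one]
  have hpos : ∀ r : ℝ, 0 ≤ r → r < 1 → 0 < C * r ^ 2 - 2 * ‖B‖ * r + D := by
    intro r h0 h1
    rw [← hray r h0]
    have := h (r * e) (by rw [mem_ball_zero_iff, hne r h0]; exact h1)
    nlinarith [norm_nonneg (a * (r * e) + b)]
  have hone : 2 * ‖B‖ ≤ C + D := by
    have h1 := norm_le_norm_of_closedBall h (hne 1 zero_le_one).le
    have h2 := hray 1 zero_le_one
    nlinarith [norm_nonneg (a * ((1 : ℝ) * e) + b)]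
  -- If `C ≥ D > 0`, either the vertex `‖B‖ / C` lies in `[0, 1)`, where the quadratic takes the
  -- negative value `-(‖B‖² - CD) / C`, or `‖B‖ ≥ C`. In the second case `2‖B‖ ≤ C + D` forces `‖B‖
  -- = C = D`, so the discriminant vanishes.
  have hCD : C < D := by
    by_contra! hDC
    have hC0 : 0 < C := hD0.trans_le hDC
    by_cases hBC : ‖B‖ < C
    · have h1 := hpos (‖B‖ / C) (by positivity) (by rwa [div_lt_one hC0])
      have h2 : C * (‖B‖ / C) ^ 2 - 2 * ‖B‖ * (‖B‖ / C) + D = -(‖B‖ ^ 2 - C * D) / C := by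
        field_simp; ring
      rw [h2, hB] at h1
      have : 0 < ‖a * d - b * c‖ ^ 2 / C := by positivity
      rw [neg_div] at h1
      linarith
    · nlinarith
  -- Since `2‖B‖ ≤ C + D`, the quadratic is at least `(1 - r)(D - C r)`. The second factor is affine
  -- in `r`, hence at least its smaller endpoint value, and `1 - r ≥ (1 - r²) / 2` accounts for the
  -- factor `1/2`.
  refine ⟨min D (D - C) / 2, by have := lt_min hD0 (sub_pos.2 hCD); linarith, fun z hz => ?_⟩
  have hz1 : ‖z‖ < 1 := mem_ball_zero_iff.1 hz
  have hz0 := norm_nonneg z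
  rw [sq_norm_sub_sq_norm, ← hBdef]
  have h1 : -(‖B‖ * ‖z‖) ≤ (B * z).re := by
    rw [← norm_mul]
    exact neg_le_of_abs_le (abs_re_le_norm _)
  have h2 : (1 - ‖z‖) * (D - C * ‖z‖) ≤ C * ‖z‖ ^ 2 + 2 * (B * z).re + D := by nlinarith
  have h3 : min D (D - C) ≤ D - C * ‖z‖ := by
    have := min_le_left D (D - C)
    have := min_le_right D (D - C)
    nlinarith
  have h4 : 0 < min D (D - C) := lt_min hD0 (sub_pos.2 hCD)
  change _ ≤ C * ‖z‖ ^ 2 + 2 * (B * z).re + D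
  nlinarith [mul_le_mul_of_nonneg_left h3 (sub_nonneg.2 hz1.le), mul_nonneg h4.le (sq_nonneg (1 - ‖z‖))]

theorem hasDerivAt {z : ℂ} (hz : c * z + d ≠ 0) :
    HasDerivAt (fun z => (a * z + b) / (c * z + d)) ((a * d - b * c) / (c * z + d) ^ 2) z := by
  have h1 : HasDerivAt (fun z => a * z + b) a z := by
    simpa using ((hasDerivAt_id z).const_mul a).add_const b
  have h2 : HasDerivAt (fun z => c * z + d) c z := by
    simpa using ((hasDerivAt_id z).const_mul c).add_const d
  exact (h1.div h2 hz).congr_deriv (by ring)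

end LinearFractional

end

/-! ### Invariance of the coefficient condition under weighted composition. -/

section

open Complex Metric MeasureTheory Filter Asymptotics
open scoped ENNReal Nat Topology

/-- `F` is holomorphic on the unit disc and its Taylor coefficients satisfy the condition that
characterizes membership in `A²_α`. -/
def CoeffSummable (α : ℝ) (F : ℂ → ℂ) : Prop :=
  DifferentiableOn ℂ F (ball 0 1) ∧
    Summable fun n : ℕ => ‖iteratedDeriv n F 0 / (n ! : ℂ)‖ ^ 2 * (n : ℝ) ^ (-(α + 1))

/-- `F` is holomorphic on a disc about `0` of radius larger than `1`. -/
def HolomorphicBeyondDisc (F : ℂ → ℂ) : Prop :=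
  ∃ R : ℝ, 1 < R ∧ DifferentiableOn ℂ F (ball 0 R)

namespace HolomorphicBeyondDisc

variable {F G : ℂ → ℂ}

theorem differentiableOn (hF : HolomorphicBeyondDisc F) : DifferentiableOn ℂ F (ball 0 1) := by
  obtain ⟨R, hR, h⟩ := hF
  exact h.mono (ball_subset_ball hR.le)

theorem deriv (hF : HolomorphicBeyondDisc F) : HolomorphicBeyondDisc (deriv F) := by
  obtain ⟨R, hR, h⟩ := hF
  exact ⟨R, hR, h.deriv isOpen_ball⟩

theorem mul (hF : HolomorphicBeyondDisc F) (hG : HolomorphicBeyondDisc G) :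
    HolomorphicBeyondDisc fun z => F z * G z := by
  obtain ⟨R, hR, h⟩ := hF
  obtain ⟨S, hS, h'⟩ := hG
  exact ⟨min R S, lt_min hR hS, (h.mono (ball_subset_ball (min_le_left _ _))).mul
    (h'.mono (ball_subset_ball (min_le_right _ _)))⟩

theorem exists_bound (hF : HolomorphicBeyondDisc F) :
    ∃ M : ℝ, 0 ≤ M ∧ ∀ z ∈ ball (0 : ℂ) 1, ‖F z‖ ≤ M := by
  obtain ⟨R, hR, h⟩ := hF
  obtain ⟨M, hM⟩ := (isCompact_closedBall (0 : ℂ) 1).exists_bound_of_continuousOn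
    (h.continuousOn.mono (closedBall_subset_ball hR))
  exact ⟨M, (norm_nonneg _).trans (hM 0 (by simp)), fun z hz => hM z (ball_subset_closedBall hz)⟩

end HolomorphicBeyondDisc

namespace CoeffSummable

variable {α β : ℝ} {F G : ℂ → ℂ}

theorem congr (hF : CoeffSummable α F) (h : Set.EqOn G F (ball 0 1)) : CoeffSummable α G := by
  refine ⟨hF.1.congr h, hF.2.congr fun n => ?_⟩
  have : G =ᶠ[𝓝 0] F := h.eventuallyEq_of_mem (ball_mem_nhds 0 one_pos)
  rw [this.iteratedDeriv_eq n]

theorem mono (hF : CoeffSummable α F) (h : α ≤ β) : CoeffSummable β F := by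
  refine ⟨hF.1, summable_of_isBigO_nat hF.2 (IsBigO.mul (isBigO_refl _ _) ?_)⟩
  refine IsBigO.of_bound 1 ?_
  filter_upwards [eventually_ge_atTop 1] with n hn
  have hn1 : (1 : ℝ) ≤ n := by exact_mod_cast hn
  rw [one_mul, Real.norm_of_nonneg (by positivity), Real.norm_of_nonneg (by positivity)]
  exact Real.rpow_le_rpow_of_exponent_le hn1 (by linarith)

theorem add (hF : CoeffSummable α F) (hG : CoeffSummable α G) :
    CoeffSummable α fun z => F z + G z := by
  refine ⟨hF.1.add hG.1, Summable.of_nonneg_of_le (fun n => by positivity) (fun n => ?_)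
    ((hF.2.add hG.2).mul_left 2)⟩
  have : iteratedDeriv n (fun z => F z + G z) 0 = iteratedDeriv n F 0 + iteratedDeriv n G 0 :=
    iteratedDeriv_add (contDiffAt_of_disc hF.1 n) (contDiffAt_of_disc hG.1 n)
  rw [this, add_div, ← add_mul, ← mul_assoc]
  refine mul_le_mul_of_nonneg_right ?_ (by positivity)
  set x := iteratedDeriv n F 0 / (n ! : ℂ)
  set y := iteratedDeriv n G 0 / (n ! : ℂ)
  nlinarith [norm_add_le x y, norm_nonneg (x + y), sq_nonneg (‖x‖ - ‖y‖)]

/-- The coefficients of `F'` are `(n + 1) a_{n+1}`, so the squared moduli gain a factor comparable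
to `n²`, which the shift of the weight by 2 absorbs. There is no restriction on `α`, so this can be
used to climb from negative weights to nonnegative ones. -/
theorem iff_deriv (hF : DifferentiableOn ℂ F (ball 0 1)) :
    CoeffSummable α F ↔ CoeffSummable (α + 2) (deriv F) := by
  rw [CoeffSummable, CoeffSummable, and_iff_right hF, and_iff_right (hF.deriv isOpen_ball),
    ← summable_nat_add_iff (f := fun n : ℕ =>
      ‖iteratedDeriv n F 0 / (n ! : ℂ)‖ ^ 2 * (n : ℝ) ^ (-(α + 1))) 1]
  have h1 : ∀ n : ℕ, ‖iteratedDeriv n (deriv F) 0 / (n ! : ℂ)‖ ^ 2 * (n : ℝ) ^ (-(α + 2 + 1)) =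
      ‖iteratedDeriv (n + 1) F 0 / ((n + 1) ! : ℂ)‖ ^ 2 *
        (((n + 1 : ℕ) : ℝ) ^ (2 : ℝ) * (n : ℝ) ^ (-(α + 2 + 1))) := by
    intro n
    have : ((n : ℝ) + 1) ≠ 0 := by positivity
    have : (n ! : ℝ) ≠ 0 := by positivity
    have hn : ‖(n : ℂ) + 1‖ = n + 1 := by exact_mod_cast Complex.norm_natCast (n + 1)
    rw [iteratedDeriv_succ', norm_div, norm_div, Nat.factorial_succ, Real.rpow_ofNat]
    push_cast
    rw [norm_mul, norm_natCast, hn]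
    field_simp
  simp_rw [h1]
  refine BergmanAux.summable_iff_of_isTheta ((isTheta_refl _ _).mul ?_)
  refine (BergmanAux.rpow_isTheta_shift _ 1).trans
    (IsTheta.symm (((BergmanAux.rpow_isTheta_shift 2 1).mul (isTheta_refl _ _)).trans_eventuallyEq ?_))
  filter_upwards [eventually_gt_atTop 0] with n hn
  have hn0 : (0 : ℝ) < n := by exact_mod_cast hn
  rw [← Real.rpow_add hn0]
  congr 1
  ring

/-- For `α > -1` no derivative is needed to describe the space: this is the case `k = 0` of
`BergmanAux.memLp_iff_summable`. -/
theorem iff_lintegral_lt_top (hF : DifferentiableOn ℂ F (ball 0 1)) (hα : -1 < α) :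
    CoeffSummable α F ↔
      ∫⁻ z in ball (0 : ℂ) 1, ENNReal.ofReal ((1 - ‖z‖ ^ 2) ^ α) * ‖F z‖ₑ ^ 2 < ⊤ := by
  have hdens : Measurable fun z : ℂ => ENNReal.ofReal ((1 - ‖z‖ ^ 2) ^ α) := by fun_prop
  have hae : AEStronglyMeasurable F (volume.restrict (ball (0 : ℂ) 1)) :=
    hF.continuousOn.aestronglyMeasurable measurableSet_ball
  have hae' := hae.mono_ac (withDensity_absolutelyContinuous _
    (fun z : ℂ => ENNReal.ofReal ((1 - ‖z‖ ^ 2) ^ α)))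
  rw [CoeffSummable, and_iff_right hF, ← BergmanAux.memLp_iff_summable hF α 0 (by simpa using hα)]
  simp only [pow_zero, one_mul, iteratedDeriv_zero]
  rw [MemLp, and_iff_right hae',
    eLpNorm_lt_top_iff_lintegral_rpow_enorm_lt_top two_ne_zero ENNReal.ofNat_ne_top,
    lintegral_withDensity_eq_lintegral_mul₀ hdens.aemeasurable (hae.enorm.pow_const _)]
  simp

end CoeffSummable

theorem LinearFractional.differentiableOn_comp {a b c d : ℂ} {F f : ℂ → ℂ}
    (h : ∀ z ∈ ball (0 : ℂ) 1, ‖a * z + b‖ < ‖c * z + d‖) (hF : HolomorphicBeyondDisc F)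
    (hf : DifferentiableOn ℂ f (ball 0 1)) :
    DifferentiableOn ℂ (fun z => F z * f ((a * z + b) / (c * z + d))) (ball 0 1) := by
  have hne : ∀ z ∈ ball (0 : ℂ) 1, c * z + d ≠ 0 := fun z hz =>
    norm_pos_iff.1 ((norm_nonneg _).trans_lt (h z hz))
  refine hF.differentiableOn.mul (hf.comp (fun z hz =>
    (LinearFractional.hasDerivAt (hne z hz)).differentiableAt.differentiableWithinAt) fun z hz => ?_)
  rw [mem_ball_zero_iff, norm_div, div_lt_one ((norm_nonneg _).trans_lt (h z hz))]
  exact h z hz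

/-- The Jacobian in the area change of variables under a holomorphic map with derivative `w`. -/
theorem abs_det_restrictScalars_toSpanSingleton (w : ℂ) :
    |((ContinuousLinearMap.toSpanSingleton ℂ w).restrictScalars ℝ).det| = ‖w‖ ^ 2 := by
  have : ((ContinuousLinearMap.toSpanSingleton ℂ w).restrictScalars ℝ).det = ‖w‖ ^ 2 := by
    simp [ContinuousLinearMap.det, LinearMap.det_restrictScalars, Algebra.norm_complex_eq,
      Complex.normSq_eq_norm_sq]
  rw [this, abs_of_nonneg (by positivity)]

/-- Weighted composition with a linear fractional self-map, for weights `α ≥ 0`. -/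
theorem CoeffSummable.comp_of_nonneg {α : ℝ} (hα : 0 ≤ α) {a b c d : ℂ}
    (hdet : a * d - b * c ≠ 0) (h : ∀ z ∈ ball (0 : ℂ) 1, ‖a * z + b‖ < ‖c * z + d‖)
    {F f : ℂ → ℂ} (hF : HolomorphicBeyondDisc F) (hf : CoeffSummable α f) :
    CoeffSummable α fun z => F z * f ((a * z + b) / (c * z + d)) := by
  have hpos : ∀ z ∈ ball (0 : ℂ) 1, 0 < ‖c * z + d‖ := fun z hz =>
    (norm_nonneg _).trans_lt (h z hz)
  have hne : ∀ z ∈ ball (0 : ℂ) 1, c * z + d ≠ 0 := fun z hz => norm_pos_iff.1 (hpos z hz)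
  rw [iff_lintegral_lt_top (LinearFractional.differentiableOn_comp h hF hf.1) (by linarith)]
  have hf' := (iff_lintegral_lt_top hf.1 (by linarith)).1 hf
  obtain ⟨B, hB0, hB⟩ := hF.exists_bound
  obtain ⟨m, hm, hlow⟩ := LinearFractional.exists_lower_bound hdet h
  set τ : ℂ → ℂ := fun z => (a * z + b) / (c * z + d) with hτ
  set τ' : ℂ → ℂ := fun z => (a * d - b * c) / (c * z + d) ^ 2 with hτ'
  set M : ℝ := ‖c‖ + ‖d‖ with hM
  have hM0 : 0 < M := by
    have := hpos 0 (by simp)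
    simp only [mul_zero, zero_add] at this
    positivity
  have hcM : ∀ z ∈ ball (0 : ℂ) 1, ‖c * z + d‖ ≤ M := fun z hz => by
    have h1 := norm_add_le (c * z) d
    rw [norm_mul] at h1
    have h2 : ‖z‖ < 1 := mem_ball_zero_iff.1 hz
    nlinarith [norm_nonneg c]
  have hdet0 : 0 < ‖a * d - b * c‖ := norm_pos_iff.2 hdet
  have hmaps : Set.MapsTo τ (ball 0 1) (ball 0 1) := fun z hz => by
    rw [mem_ball_zero_iff, hτ, norm_div, div_lt_one (hpos z hz)]
    exact h z hz
  have hinj : Set.InjOn τ (ball 0 1) := by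
    intro z hz w hw hzw
    simp only [hτ] at hzw
    rw [div_eq_div_iff (hne z hz) (hne w hw)] at hzw
    have : (a * d - b * c) * (z - w) = 0 := by linear_combination hzw
    exact sub_eq_zero.1 ((mul_eq_zero.1 this).resolve_left hdet)
  have hcv := lintegral_image_eq_lintegral_abs_det_fderiv_mul (μ := volume) (f := τ)
    (s := ball (0 : ℂ) 1)
    (f' := fun z => (ContinuousLinearMap.toSpanSingleton ℂ (τ' z)).restrictScalars ℝ)
    measurableSet_ball
    (fun z hz => ((LinearFractional.hasDerivAt (hne z hz)).hasFDerivAt.restrictScalars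
      ℝ).hasFDerivWithinAt) hinj
    (fun w => ENNReal.ofReal ((1 - ‖w‖ ^ 2) ^ α) * ‖f w‖ₑ ^ 2)
  simp only [abs_det_restrictScalars_toSpanSingleton] at hcv
  have hfin : ∫⁻ z in ball (0 : ℂ) 1, ENNReal.ofReal (‖τ' z‖ ^ 2) *
      (ENNReal.ofReal ((1 - ‖τ z‖ ^ 2) ^ α) * ‖f (τ z)‖ₑ ^ 2) < ⊤ := by
    rw [← hcv]
    exact (lintegral_mono_set hmaps.image_subset).trans_lt hf'
  -- The first factor compares the weights at `z` and `τ z`. The rest bounds `|F|²` by a multiple of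
  -- `|τ'|²`, since `|τ'| ≥ |ad - bc| / M²` on the disc.
  set L : ℝ := (M ^ 2 / m) ^ α * (B ^ 2 * (M ^ 4 / ‖a * d - b * c‖ ^ 2)) with hL
  have hbd : ∀ z ∈ ball (0 : ℂ) 1,
      (1 - ‖z‖ ^ 2) ^ α * ‖F z‖ ^ 2 ≤ L * (‖τ' z‖ ^ 2 * (1 - ‖τ z‖ ^ 2) ^ α) := by
    intro z hz
    have hz1 : 0 < 1 - ‖z‖ ^ 2 := by
      have := mem_ball_zero_iff.1 hz
      nlinarith [norm_nonneg z]
    have hp := hpos z hz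
    have e1 : 1 - ‖z‖ ^ 2 ≤ M ^ 2 / m * (1 - ‖τ z‖ ^ 2) := by
      have e2 : 1 - ‖τ z‖ ^ 2 = (‖c * z + d‖ ^ 2 - ‖a * z + b‖ ^ 2) / ‖c * z + d‖ ^ 2 := by
        simp only [hτ, norm_div]
        rw [div_pow, sub_div, div_self (by positivity)]
      have e3 := hlow z hz
      rw [e2, div_mul_div_comm, le_div_iff₀ (by positivity)]
      have e4 : ‖c * z + d‖ ^ 2 ≤ M ^ 2 := pow_le_pow_left₀ hp.le (hcM z hz) 2
      calc (1 - ‖z‖ ^ 2) * (m * ‖c * z + d‖ ^ 2) = ‖c * z + d‖ ^ 2 * (m * (1 - ‖z‖ ^ 2)) := by ring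
        _ ≤ M ^ 2 * (‖c * z + d‖ ^ 2 - ‖a * z + b‖ ^ 2) := by gcongr
    have h1τ : 0 ≤ 1 - ‖τ z‖ ^ 2 := by
      have := mem_ball_zero_iff.1 (hmaps hz)
      nlinarith [norm_nonneg (τ z)]
    -- The only place where `α ≥ 0` is essential: the comparison of `1 - |z|²` with `1 - |τ z|²` is
    -- one-sided, so the power must be increasing.
    have e5 : (1 - ‖z‖ ^ 2) ^ α ≤ (M ^ 2 / m) ^ α * (1 - ‖τ z‖ ^ 2) ^ α := by
      rw [← Real.mul_rpow (by positivity) h1τ]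
      exact Real.rpow_le_rpow hz1.le e1 hα
    have e6 : 1 ≤ M ^ 4 / ‖a * d - b * c‖ ^ 2 * ‖τ' z‖ ^ 2 := by
      have e7 : M ^ 4 / ‖a * d - b * c‖ ^ 2 * ‖τ' z‖ ^ 2 = M ^ 4 / ‖c * z + d‖ ^ 4 := by
        simp only [hτ', norm_div, norm_pow]
        field_simp
      rw [e7, one_le_div (by positivity)]
      exact pow_le_pow_left₀ hp.le (hcM z hz) 4
    have e8 : ‖F z‖ ^ 2 ≤ B ^ 2 * (M ^ 4 / ‖a * d - b * c‖ ^ 2 * ‖τ' z‖ ^ 2) :=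
      (pow_le_pow_left₀ (norm_nonneg _) (hB z hz) 2).trans
        (le_mul_of_one_le_right (by positivity) e6)
    calc (1 - ‖z‖ ^ 2) ^ α * ‖F z‖ ^ 2
        ≤ ((M ^ 2 / m) ^ α * (1 - ‖τ z‖ ^ 2) ^ α) *
          (B ^ 2 * (M ^ 4 / ‖a * d - b * c‖ ^ 2 * ‖τ' z‖ ^ 2)) := by gcongr
      _ = L * (‖τ' z‖ ^ 2 * (1 - ‖τ z‖ ^ 2) ^ α) := by rw [hL]; ring
  have hL0 : 0 ≤ L := by positivity
  refine lt_of_le_of_lt ?_ (ENNReal.mul_lt_top (ENNReal.ofReal_lt_top (r := L)) hfin)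
  rw [← lintegral_const_mul' _ _ ENNReal.ofReal_ne_top]
  refine setLIntegral_mono' measurableSet_ball fun z hz => ?_
  have e9 : ‖F z * f (τ z)‖ₑ ^ 2 = ENNReal.ofReal (‖F z‖ ^ 2) * ‖f (τ z)‖ₑ ^ 2 := by
    rw [enorm_mul, mul_pow, ENNReal.ofReal_pow (norm_nonneg _), ofReal_norm]
  have hz1 : 0 ≤ 1 - ‖z‖ ^ 2 := by
    have := mem_ball_zero_iff.1 hz
    nlinarith [norm_nonneg z]
  change ENNReal.ofReal _ * ‖F z * f (τ z)‖ₑ ^ 2 ≤ _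
  rw [e9, ← mul_assoc, ← mul_assoc, ← mul_assoc, ← ENNReal.ofReal_mul (by positivity),
    ← ENNReal.ofReal_mul hL0, ← ENNReal.ofReal_mul (by positivity)]
  exact mul_le_mul' (ENNReal.ofReal_le_ofReal (by rw [mul_assoc]; exact hbd z hz)) le_rfl

/-- Weighted composition with a linear fractional self-map preserves `A²_α`. -/
theorem CoeffSummable.comp {α : ℝ} {a b c d : ℂ}
    (hdet : a * d - b * c ≠ 0) (h : ∀ z ∈ ball (0 : ℂ) 1, ‖a * z + b‖ < ‖c * z + d‖)
    {F f : ℂ → ℂ} (hF : HolomorphicBeyondDisc F) (hf : CoeffSummable α f) :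
    CoeffSummable α fun z => F z * f ((a * z + b) / (c * z + d)) := by
  obtain ⟨n, hn⟩ : ∃ n : ℕ, 0 ≤ α + 2 * n := by
    obtain ⟨n, hn⟩ := exists_nat_ge (-α)
    exact ⟨n, by linarith [(Nat.cast_nonneg n : (0 : ℝ) ≤ n)]⟩
  -- The weight `F` has to vary in the induction, because differentiating replaces it by `F'` and by
  -- `F τ'`.
  induction n generalizing α F f with
  | zero => exact comp_of_nonneg (by simpa using hn) hdet h hF hf
  | succ n ih =>
    have hpos : ∀ z ∈ ball (0 : ℂ) 1, 0 < ‖c * z + d‖ := fun z hz =>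
      (norm_nonneg _).trans_lt (h z hz)
    have hne : ∀ z ∈ ball (0 : ℂ) 1, c * z + d ≠ 0 := fun z hz => norm_pos_iff.1 (hpos z hz)
    have hn' : 0 ≤ α + 2 + 2 * n := by push_cast at hn; linarith
    have hτ' : HolomorphicBeyondDisc fun z => (a * d - b * c) / (c * z + d) ^ 2 := by
      obtain ⟨R, hR, hcd⟩ := LinearFractional.exists_radius
        (LinearFractional.norm_lt_norm_of_det_ne_zero hdet h)
      refine ⟨R, hR, fun z hz => ?_⟩
      have hz0 : c * z + d ≠ 0 := by
        intro h0
        have := hcd z hz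
        rw [eq_neg_of_add_eq_zero_left h0, norm_neg] at this
        exact lt_irrefl _ this
      exact DifferentiableAt.differentiableWithinAt (by fun_prop (disch := exact pow_ne_zero 2 hz0))
    rw [iff_deriv (LinearFractional.differentiableOn_comp h hF hf.1)]
    -- The product rule gives two weighted compositions at level `α + 2`: one of `f`, which belongs
    -- to the larger space by `mono`, and one of `f'`, by `iff_deriv`.
    refine ((ih hF.deriv (hf.mono (by linarith)) hn').add
      (ih (hF.mul hτ') ((iff_deriv hf.1).1 hf) hn')).congr fun z hz => ?_
    have hmem : (a * z + b) / (c * z + d) ∈ ball (0 : ℂ) 1 := by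
      rw [mem_ball_zero_iff, norm_div, div_lt_one (hpos z hz)]
      exact h z hz
    have h1 := (hF.differentiableOn.differentiableAt (isOpen_ball.mem_nhds hz)).hasDerivAt
    have h2 := (hf.1.differentiableAt (isOpen_ball.mem_nhds hmem)).hasDerivAt
    have h3 : HasDerivAt (fun z => f ((a * z + b) / (c * z + d))) _ z :=
      h2.comp z (LinearFractional.hasDerivAt (hne z hz))
    refine (h1.mul h3).deriv.trans ?_
    ring

end

/-! ### Continuous logarithms and the weights `g` and `h`. -/

section

open Complex Metric Filter
open scoped Topology

/-- Two continuous logarithms of the same function on a connected space that agree at a point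
are equal. -/
theorem eq_of_exp_eq {X : Type*} [TopologicalSpace X] [PreconnectedSpace X] {u v : X → ℂ}
    (hu : Continuous u) (hv : Continuous v) (h : ∀ x, exp (u x) = exp (v x)) {x₀ : X}
    (h₀ : u x₀ = v x₀) (x : X) : u x = v x :=
  congrFun (isCoveringMap_exp.eq_of_comp_eq hu hv (funext fun x => Subtype.ext (h x)) x₀ h₀) x

instance : PreconnectedSpace 𝔻 :=
  Subtype.preconnectedSpace (convex_ball (0 : ℂ) 1).isPreconnected

/-- A power of an affine function without zeros on the closed disc extends holomorphically
across the unit circle. -/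
theorem exists_holomorphicBeyondDisc_exp_mul_log {c d : ℂ} (hcd : ‖c‖ < ‖d‖) {l : 𝔻 → ℂ}
    (hl : Continuous l) (hexp : ∀ z : 𝔻, exp (l z) = c * z + d) (s : ℂ) :
    ∃ F : ℂ → ℂ, HolomorphicBeyondDisc F ∧ ∀ z : 𝔻, F z = exp (s * l z) := by
  obtain ⟨R, hR, hRcd⟩ := LinearFractional.exists_radius hcd
  have hd : d ≠ 0 := norm_pos_iff.1 ((norm_nonneg c).trans_lt hcd)
  have hslit : ∀ z ∈ ball (0 : ℂ) R, 1 + c * z / d ∈ slitPlane := fun z hz => by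
    refine mem_slitPlane_of_norm_lt_one ?_
    rw [norm_div, div_lt_one (norm_pos_iff.2 hd)]
    exact hRcd z hz
  have hmem : ∀ z : 𝔻, (z : ℂ) ∈ ball (0 : ℂ) R := fun z =>
    mem_ball_zero_iff.2 (z.norm_lt_one.trans hR)
  -- The given branch differs from the principal logarithm of `1 + cz/d` by the constant `l 0`, and
  -- the latter is defined beyond the unit circle because `|cz/d| < 1` there.
  have hlog : ∀ z : 𝔻, l z = l 0 + log (1 + c * z / d) := by
    refine eq_of_exp_eq hl (continuous_const.add (Continuous.clog ?_ fun z => hslit z (hmem z)))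
      (fun z => ?_) (x₀ := 0) (by simp)
    · have := UnitDisc.continuous_coe
      fun_prop
    · rw [exp_add, exp_log (slitPlane_ne_zero (hslit z (hmem z))), hexp, hexp]
      simp only [UnitDisc.coe_zero]
      field_simp
      ring
  refine ⟨fun z => exp (s * (l 0 + log (1 + c * z / d))), ⟨R, hR, fun z hz => ?_⟩, fun z => by
    rw [hlog z]⟩
  have := hslit z hz
  exact DifferentiableAt.differentiableWithinAt (by fun_prop (disch := exact this))

theorem memBergman_iff_coeffSummable {α : ℝ} {f : 𝔻 → ℂ} :
    MemBergman α f ↔ CoeffSummable α (discExtend f) := memBergman_iff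

/-- Weighted composition with a linear fractional self-map of the disc preserves `A²_α`. -/
theorem MemBergman.comp_linearFractional {α : ℝ} {a b c d : ℂ} (hdet : a * d - b * c ≠ 0)
    (h : ∀ z ∈ ball (0 : ℂ) 1, ‖a * z + b‖ < ‖c * z + d‖) {ρ : 𝔻 → 𝔻}
    (hρ : ∀ z : 𝔻, (ρ z : ℂ) = (a * z + b) / (c * z + d)) {G : 𝔻 → ℂ} {F : ℂ → ℂ}
    (hF : HolomorphicBeyondDisc F) (hFG : ∀ z : 𝔻, F z = G z) {f : 𝔻 → ℂ} (hf : MemBergman α f) :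
    MemBergman α fun z => G z * f (ρ z) := by
  rw [memBergman_iff_coeffSummable] at hf ⊢
  refine (hf.comp hdet h hF).congr fun z hz => ?_
  lift z to 𝔻 using mem_ball_zero_iff.1 hz
  beta_reduce
  rw [discExtend_coe, hFG, ← hρ, discExtend_coe]

/-! ### Reproducing kernels under weighted composition. -/

namespace BergmanSpace

variable {α : ℝ} {K : BergmanKernel α}

/-- The reproducing kernel at the point `w`. -/
noncomputable def kernelAt (K : BergmanKernel α) (w : 𝔻) : BergmanSpace K := (reproducing K w).choose

theorem kernelAt_apply (w z : 𝔻) : kernelAt K w z = K.toFun z w :=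
  (reproducing K w).choose_spec.1 z

theorem inner_kernelAt (w : 𝔻) (f : BergmanSpace K) : inner ℂ (kernelAt K w) f = f w :=
  (reproducing K w).choose_spec.2 f

@[ext] theorem ext {f g : BergmanSpace K} (h : ∀ z, f z = g z) : f = g := Subtype.ext (funext h)

/-- Evaluation at a point of the disc. -/
def eval (K : BergmanKernel α) (z : 𝔻) : BergmanSpace K →ₗ[ℂ] ℂ where
  toFun f := f z
  map_add' _ _ := rfl
  map_smul' _ _ := rfl

theorem eval_apply (z : 𝔻) (f : BergmanSpace K) : eval K z f = f z := rfl

theorem continuous_eval (z : 𝔻) : Continuous (eval K z) := by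
  have : ⇑(eval K z) = fun f => inner ℂ (kernelAt K z) f := funext fun f => (inner_kernelAt z f).symm
  rw [this]
  fun_prop

/-- A weighted composition operator that maps `A²_α` into itself is bounded. -/
theorem exists_weightedComp (ρ : 𝔻 → 𝔻) (G : 𝔻 → ℂ)
    (h : ∀ f : BergmanSpace K, MemBergman α fun z => G z * f (ρ z)) :
    ∃ T : BergmanSpace K →L[ℂ] BergmanSpace K, ∀ f z, T f z = G z * f (ρ z) := by
  let T : BergmanSpace K →ₗ[ℂ] BergmanSpace K :=
    { toFun := fun f => ⟨fun z => G z * f (ρ z), h f⟩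
      map_add' := fun f g => ext fun z => mul_add (G z) (f (ρ z)) (g (ρ z))
      map_smul' := fun s f => ext fun z => mul_left_comm (G z) s (f (ρ z)) }
  -- Closed graph theorem: point evaluations are continuous, so a limit in the graph can be
  -- identified pointwise.
  refine ⟨ContinuousLinearMap.ofSeqClosedGraph (g := T) fun u x y hx hy => ext fun z => ?_,
    fun f z => rfl⟩
  have h1 := ((continuous_eval z).tendsto y).comp hy
  have h2 := (((continuous_eval (ρ z)).tendsto x).comp hx).const_mul (G z)
  exact tendsto_nhds_unique h1 h2

theorem adjoint_kernelAt {ρ : 𝔻 → 𝔻} {G : 𝔻 → ℂ} {T : BergmanSpace K →L[ℂ] BergmanSpace K}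
    (hT : ∀ f z, T f z = G z * f (ρ z)) (w : 𝔻) :
    ContinuousLinearMap.adjoint T (kernelAt K w) = conj (G w) • kernelAt K (ρ w) := by
  refine ext_inner_right ℂ fun f => ?_
  rw [ContinuousLinearMap.adjoint_inner_left, inner_kernelAt, hT, inner_smul_left, conj_conj,
    inner_kernelAt]

/-- A function orthogonal to every kernel function vanishes at every point, so a closed subspace
containing them has trivial orthogonal complement. -/
theorem eq_top_of_kernelAt_mem {W : Submodule ℂ (BergmanSpace K)}
    (hW : IsClosed (W : Set (BergmanSpace K))) (h : ∀ w, kernelAt K w ∈ W) : W = ⊤ := by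
  have : CompleteSpace W := hW.completeSpace_coe
  rw [← Submodule.orthogonal_eq_bot_iff, Submodule.eq_bot_iff]
  intro f hf
  refine ext fun w => ?_
  rw [← inner_kernelAt]
  exact hf _ (h w)

/-- A finite-dimensional `V` is closed, hence so is its preimage under `T`, and kernel functions
suffice. With `V` a finite span this gives finite rank; with `V = ⊥` it gives `T = 0`. -/
theorem map_mem_of_map_kernelAt_mem {T : BergmanSpace K →L[ℂ] BergmanSpace K}
    {V : Submodule ℂ (BergmanSpace K)} [FiniteDimensional ℂ V] (h : ∀ w, T (kernelAt K w) ∈ V)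
    (f : BergmanSpace K) : T f ∈ V := by
  have hcl : IsClosed ((V.comap (T : BergmanSpace K →ₗ[ℂ] BergmanSpace K) :
      Submodule ℂ (BergmanSpace K)) : Set (BergmanSpace K)) :=
    V.closed_of_finiteDimensional.preimage T.continuous
  have := eq_top_of_kernelAt_mem hcl h
  exact (Submodule.eq_top_iff'.1 this) f

theorem exists_monomial (K : BergmanKernel α) (j : ℕ) :
    ∃ e : BergmanSpace K, ∀ z : 𝔻, e z = (z : ℂ) ^ j := by
  obtain ⟨e, he⟩ := exists_of_coeff (K := K) (Pi.single j 1)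
    (summable_of_ne_finset_zero (s := {j}) fun n hn => by
      simp [Pi.single_eq_of_ne (Finset.notMem_singleton.1 hn)])
  refine ⟨e, fun z => (e.hasSum z).unique ?_⟩
  have := hasSum_single (f := fun n => taylorCoeff e n * (z : ℂ) ^ n) j fun n hn => by
    simp [he, Pi.single_eq_of_ne hn]
  simpa [he] using this

end BergmanSpace

/-- The kernel factors compatibly with a linear fractional map and its Kreĭn adjoint. -/
theorem LinearFractional.one_sub_adjoint_mul {a b c d : ℂ} {φ σ : 𝔻 → 𝔻}
    (hφ : ∀ z : 𝔻, c * z + d ≠ 0 ∧ (φ z : ℂ) = (a * z + b) / (c * z + d))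
    (hσ : ∀ z : 𝔻, -conj b * z + conj d ≠ 0 ∧
        (σ z : ℂ) = (conj a * z - conj c) / (-conj b * z + conj d)) (z w : 𝔻) :
    (-conj b * z + conj d) * (1 - σ z * conj (w : ℂ)) =
      conj (c * w + d) * (1 - z * conj (φ w : ℂ)) := by
  have h1 : (-conj b * z + conj d) * (σ z : ℂ) = conj a * z - conj c := by
    rw [(hσ z).2, mul_div_cancel₀ _ (hσ z).1]
  have h2 : conj (c * w + d) * conj (φ w : ℂ) = conj (a * w + b) := by
    rw [← map_mul, (hφ w).2, mul_div_cancel₀ _ (hφ w).1]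
  simp only [map_add, map_mul] at h1 h2 ⊢
  linear_combination (-conj (w : ℂ)) * h1 + (z : ℂ) * h2

theorem one_sub_mul_conj_mem_slitPlane (z w : 𝔻) : 1 - (z : ℂ) * conj (w : ℂ) ∈ slitPlane := by
  rw [sub_eq_add_neg]
  refine mem_slitPlane_of_norm_lt_one ?_
  rw [norm_neg, norm_mul, RCLike.norm_conj]
  exact mul_lt_one_of_nonneg_of_lt_one_left (norm_nonneg _) z.norm_lt_one w.norm_lt_one.le

theorem continuous_linearFractional {a b c d : ℂ} {ρ : 𝔻 → 𝔻}
    (hρ : ∀ z : 𝔻, c * z + d ≠ 0 ∧ (ρ z : ℂ) = (a * z + b) / (c * z + d)) :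
    Continuous fun z => (ρ z : ℂ) := by
  simp_rw [fun z => (hρ z).2]
  have := UnitDisc.continuous_coe
  exact Continuous.div (by fun_prop) (by fun_prop) fun z => (hρ z).1

/-- The transformation rule of the principal part of the kernel. -/
theorem LinearFractional.exp_mul_cpow {a b c d : ℂ} {φ σ : 𝔻 → 𝔻}
    (hφ : ∀ z : 𝔻, c * z + d ≠ 0 ∧ (φ z : ℂ) = (a * z + b) / (c * z + d))
    (hσ : ∀ z : 𝔻, -conj b * z + conj d ≠ 0 ∧
        (σ z : ℂ) = (conj a * z - conj c) / (-conj b * z + conj d))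
    {logh logg : 𝔻 → ℂ} (hlogh : Continuous logh) (hlogg : Continuous logg)
    (hexph : ∀ z : 𝔻, exp (logh z) = c * z + d)
    (hexpg : ∀ z : 𝔻, exp (logg z) = -conj b * z + conj d)
    (hbranch : logg 0 = conj (logh 0)) (s : ℝ) (z w : 𝔻) :
    exp (-(s : ℂ) * logg z) * conj (exp ((s : ℂ) * logh w)) *
      (1 - σ z * conj (w : ℂ)) ^ (-(s : ℂ)) = (1 - z * conj (φ w : ℂ)) ^ (-(s : ℂ)) := by
  have hσ' : Continuous fun z => (σ z : ℂ) :=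
    continuous_linearFractional (c := -conj b) (a := conj a) (b := -conj c) (d := conj d)
      fun z => by simpa [sub_eq_add_neg] using hσ z
  have hφ' := continuous_linearFractional hφ
  have hco := UnitDisc.continuous_coe
  have hne : ∀ z w : 𝔻, 1 - (z : ℂ) * conj (w : ℂ) ≠ 0 := fun z w =>
    slitPlane_ne_zero (one_sub_mul_conj_mem_slitPlane z w)
  -- Both sides are continuous logarithms of the two sides of `one_sub_adjoint_mul`. At `(0, 0)` the
  -- principal logarithms are `log 1 = 0`, and `hbranch` gives equality.
  have key : ∀ p : 𝔻 × 𝔻, logg p.1 + log (1 - σ p.1 * conj (p.2 : ℂ)) =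
      conj (logh p.2) + log (1 - p.1 * conj (φ p.2 : ℂ)) := by
    refine eq_of_exp_eq (x₀ := (0, 0)) ?_ ?_ (fun p => ?_) (by simp [hbranch])
    · refine (hlogg.comp continuous_fst).add (Continuous.clog ?_ fun p =>
        one_sub_mul_conj_mem_slitPlane (σ p.1) p.2)
      have h1 := hσ'.comp (continuous_fst (X := 𝔻) (Y := 𝔻))
      have h2 := continuous_conj.comp (hco.comp (continuous_snd (X := 𝔻) (Y := 𝔻)))
      exact continuous_const.sub (h1.mul h2)
    · refine (continuous_conj.comp (hlogh.comp continuous_snd)).add (Continuous.clog ?_ fun p =>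
        one_sub_mul_conj_mem_slitPlane p.1 (φ p.2))
      have h1 := hco.comp (continuous_fst (X := 𝔻) (Y := 𝔻))
      have h2 := continuous_conj.comp (hφ'.comp (continuous_snd (X := 𝔻) (Y := 𝔻)))
      exact continuous_const.sub (h1.mul h2)
    · rw [exp_add, exp_add, exp_log (hne _ _), exp_log (hne _ _), exp_conj, hexpg, hexph]
      exact one_sub_adjoint_mul hφ hσ p.1 p.2
  have hk := key (z, w)
  rw [cpow_def_of_ne_zero (hne _ _), cpow_def_of_ne_zero (hne _ _), ← exp_conj, ← exp_add,
    ← exp_add, map_mul, conj_ofReal]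
  congr 1
  linear_combination (-(s : ℂ)) * hk

end

/-! ### The adjoint formula. -/

theorem theorem2p5 (α : ℝ) (hα : ∀ m : ℕ, α + 2 ≠ -(m : ℝ)) (K : BergmanKernel α)
    (a b c d : ℂ) (hdet : a * d - b * c ≠ 0) (φ : 𝔻 → 𝔻)
    (hφ : ∀ z : 𝔻, c * z + d ≠ 0 ∧ (φ z : ℂ) = (a * z + b) / (c * z + d))
    (logh logg : 𝔻 → ℂ) (hlogh : Continuous logh) (hlogg : Continuous logg)
    (hexph : ∀ z : 𝔻, Complex.exp (logh z) = c * z + d)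
    (hexpg : ∀ z : 𝔻, Complex.exp (logg z) = -conj b * z + conj d)
    (hbranch : logg 0 = conj (logh 0)) :
    ∃ σ : 𝔻 → 𝔻,
      (∀ z : 𝔻, -conj b * z + conj d ≠ 0 ∧
        (σ z : ℂ) = (conj a * z - conj c) / (-conj b * z + conj d)) ∧
      ∃ Cφ Cσ Mg Mh : BergmanSpace K →L[ℂ] BergmanSpace K,
        (∀ (f : BergmanSpace K) (z : 𝔻), Cφ f z = f (φ z)) ∧
        (∀ (f : BergmanSpace K) (z : 𝔻), Cσ f z = f (σ z)) ∧
        (∀ (f : BergmanSpace K) (z : 𝔻),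
          Mg f z = Complex.exp ((-(α : ℂ) - 2) * logg z) * f z) ∧
        (∀ (f : BergmanSpace K) (z : 𝔻),
          Mh f z = Complex.exp (((α : ℂ) + 2) * logh z) * f z) ∧
        FiniteDimensional ℂ (ContinuousLinearMap.adjoint Cφ -
          Mg ∘L Cσ ∘L ContinuousLinearMap.adjoint Mh).range ∧
        (0 < α + 2 → ContinuousLinearMap.adjoint Cφ =
          Mg ∘L Cσ ∘L ContinuousLinearMap.adjoint Mh) := by
  have hself : ∀ z ∈ Metric.ball (0 : ℂ) 1, ‖a * z + b‖ < ‖c * z + d‖ := by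
    intro z hz
    lift z to 𝔻 using mem_ball_zero_iff.1 hz
    have h1 := (φ z).norm_lt_one
    rwa [(hφ z).2, norm_div, div_lt_one (norm_pos_iff.2 (hφ z).1)] at h1
  have hself' : ∀ z ∈ Metric.ball (0 : ℂ) 1,
      ‖conj a * z + -conj c‖ < ‖-conj b * z + conj d‖ := fun z hz => by
    rw [← sub_eq_add_neg]
    exact LinearFractional.norm_adjoint_lt hdet hself (mem_ball_zero_iff.1 hz)
  have hdet' : conj a * conj d - -conj c * -conj b ≠ 0 := by
    have e : conj a * conj d - -conj c * -conj b = conj (a * d - b * c) := by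
      simp only [map_sub, map_mul]; ring
    rw [e]
    exact (map_ne_zero _).2 hdet
  have hpos' : ∀ z : 𝔻, 0 < ‖-conj b * z + conj d‖ := fun z =>
    (norm_nonneg _).trans_lt (hself' z (mem_ball_zero_iff.2 z.norm_lt_one))
  obtain ⟨σ, hσ⟩ : ∃ σ : 𝔻 → 𝔻, ∀ z : 𝔻, -conj b * z + conj d ≠ 0 ∧
      (σ z : ℂ) = (conj a * z - conj c) / (-conj b * z + conj d) := by
    refine ⟨fun z => Complex.UnitDisc.mk ((conj a * z - conj c) / (-conj b * z + conj d)) ?_,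
      fun z => ⟨norm_pos_iff.1 (hpos' z), Complex.UnitDisc.coe_mk _ _⟩⟩
    rw [norm_div, div_lt_one (hpos' z), sub_eq_add_neg]
    exact hself' z (mem_ball_zero_iff.2 z.norm_lt_one)
  have hone : HolomorphicBeyondDisc fun _ => 1 := ⟨2, by norm_num, differentiableOn_const 1⟩
  obtain ⟨H, hH, hHh⟩ := exists_holomorphicBeyondDisc_exp_mul_log
    (LinearFractional.norm_lt_norm_of_det_ne_zero hdet hself) hlogh hexph ((α : ℂ) + 2)
  obtain ⟨G, hG, hGg⟩ := exists_holomorphicBeyondDisc_exp_mul_log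
    (LinearFractional.norm_lt_norm_of_det_ne_zero hdet' hself') hlogg hexpg (-(α : ℂ) - 2)
  -- Multiplication operators are weighted compositions with the identity, the linear fractional map
  -- with coefficients `1, 0, 0, 1`.
  have hid : ∀ z ∈ Metric.ball (0 : ℂ) 1, ‖1 * z + 0‖ < ‖0 * z + 1‖ := fun z hz => by
    simpa using hz
  have hiddet : (1 : ℂ) * 1 - 0 * 0 ≠ 0 := by norm_num
  obtain ⟨Cφ, hCφ⟩ := BergmanSpace.exists_weightedComp (K := K) φ (fun _ => 1) fun f =>
    f.memBergman.comp_linearFractional hdet hself (fun z => (hφ z).2) hone fun _ => rfl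
  obtain ⟨Cσ, hCσ⟩ := BergmanSpace.exists_weightedComp (K := K) σ (fun _ => 1) fun f =>
    f.memBergman.comp_linearFractional hdet' hself'
      (fun z => by rw [(hσ z).2, sub_eq_add_neg]) hone fun _ => rfl
  obtain ⟨Mg, hMg⟩ := BergmanSpace.exists_weightedComp (K := K) id _ fun f =>
    f.memBergman.comp_linearFractional hiddet hid (fun z => by simp) hG hGg
  obtain ⟨Mh, hMh⟩ := BergmanSpace.exists_weightedComp (K := K) id _ fun f =>
    f.memBergman.comp_linearFractional hiddet hid (fun z => by simp) hH hHh
  set T := ContinuousLinearMap.adjoint Cφ - Mg ∘L Cσ ∘L ContinuousLinearMap.adjoint Mh with hT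
  -- On kernel functions the principal parts cancel by `exp_mul_cpow`, and only the contributions of
  -- `Q` remain.
  have hval : ∀ w z : 𝔻, T (BergmanSpace.kernelAt K w) z =
      Polynomial.aeval ((z : ℂ) * conj (φ w : ℂ)) K.Q -
        Complex.exp ((-(α : ℂ) - 2) * logg z) * conj (Complex.exp (((α : ℂ) + 2) * logh w)) *
          Polynomial.aeval ((σ z : ℂ) * conj (w : ℂ)) K.Q := by
    intro w z
    have e1 : T (BergmanSpace.kernelAt K w) =
        ContinuousLinearMap.adjoint Cφ (BergmanSpace.kernelAt K w) -
          Mg (Cσ (ContinuousLinearMap.adjoint Mh (BergmanSpace.kernelAt K w))) := rfl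
    rw [e1, BergmanSpace.adjoint_kernelAt hCφ, BergmanSpace.adjoint_kernelAt hMh, map_one, one_smul,
      ← BergmanSpace.eval_apply, map_sub, map_smul, map_smul, map_smul, BergmanSpace.eval_apply,
      BergmanSpace.eval_apply, hMg, hCσ, BergmanSpace.kernelAt_apply, id, id,
      BergmanSpace.kernelAt_apply, smul_eq_mul, BergmanKernel.toFun, BergmanKernel.toFun]
    have e2 := LinearFractional.exp_mul_cpow hφ hσ hlogh hlogg hexph hexpg hbranch (α + 2) z w
    push_cast at e2
    rw [← e2, show (-(α : ℂ) - 2) = -((α : ℂ) + 2) by ring]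
    ring
  refine ⟨σ, hσ, Cφ, Cσ, Mg, Mh, fun f z => by rw [hCφ, one_mul], fun f z => by rw [hCσ, one_mul],
    hMg, hMh, ?_, fun hpos => ?_⟩
  · choose e he using BergmanSpace.exists_monomial K
    set n := K.Q.natDegree + 1
    -- Expanding `Q` in powers separates the variables: the first term of `hval` is a combination of
    -- the `z^j`, the second of the `g σ^j = M_g C_σ z^j`, with `w` entering only through the
    -- coefficients.
    let V : Submodule ℂ (BergmanSpace K) := Submodule.span ℂ
      (e '' (Finset.range n) ∪ (fun j => Mg (Cσ (e j))) '' (Finset.range n))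
    have hVfin : FiniteDimensional ℂ V := FiniteDimensional.span_of_finite ℂ
      (((Finset.range n).finite_toSet.image _).union ((Finset.range n).finite_toSet.image _))
    have hmem : ∀ w, T (BergmanSpace.kernelAt K w) ∈ V := by
      intro w
      have e3 : T (BergmanSpace.kernelAt K w) =
          ∑ j ∈ Finset.range n, ((K.Q.coeff j : ℂ) * conj (φ w : ℂ) ^ j) • e j -
          ∑ j ∈ Finset.range n, ((K.Q.coeff j : ℂ) *
            (conj (Complex.exp (((α : ℂ) + 2) * logh w)) * conj (w : ℂ) ^ j)) •
              Mg (Cσ (e j)) := by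
        refine BergmanSpace.ext fun z => ?_
        rw [hval, ← BergmanSpace.eval_apply, map_sub, map_sum, map_sum,
          Polynomial.aeval_eq_sum_range, Polynomial.aeval_eq_sum_range, Finset.mul_sum]
        simp only [map_smul, BergmanSpace.eval_apply, hMg, hCσ, he, smul_eq_mul, Complex.real_smul,
          id]
        congr 1 <;> exact Finset.sum_congr rfl fun j _ => by ring
      rw [e3]
      refine V.sub_mem (V.sum_mem fun j hj => V.smul_mem _ (Submodule.subset_span ?_))
        (V.sum_mem fun j hj => V.smul_mem _ (Submodule.subset_span ?_))
      · exact Or.inl ⟨j, hj, rfl⟩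
      · exact Or.inr ⟨j, hj, rfl⟩
    refine Submodule.finiteDimensional_of_le (S₂ := V) ?_
    rintro _ ⟨f, rfl⟩
    exact BergmanSpace.map_mem_of_map_kernelAt_mem hmem f
  · rw [← sub_eq_zero]
    refine ContinuousLinearMap.ext fun f => ?_
    refine (Submodule.mem_bot ℂ).1 (BergmanSpace.map_mem_of_map_kernelAt_mem (V := ⊥) (fun w => ?_) f)
    refine (Submodule.mem_bot ℂ).2 (BergmanSpace.ext fun z => ?_)
    change T (BergmanSpace.kernelAt K w) z = 0
    rw [hval, K.eq_zero_of_pos hpos]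
    simp
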